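/- Let $d\ge 2$, let $\mathbb S^d=\{x\in\mathbb R^{d+1}:|x|=1\}$ be the round sphere and $\mathbb S^d_+=\mathbb S^d\cap\{x_{d+1}>0\}$ the open hemisphere. Let $N^D(z)$ and $N^N(z)$ be the numbers of eigenvalues $\le z$, counted with multiplicity, of the Dirichlet and of the Neumann Laplacian $-\Delta$ on $\mathbb S^d_+$. Eigenvalues and eigenfunctions are taken in the weak sense: $u\ne 0$ and $\lambda\in\mathbb R$ with $$\int_{\mathbb S^d_+}\nabla u\cdot\nabla\varphi=\lambda\int_{\mathbb S^d_+}u\varphi$$ for all $\varphi$ in the energy space, with $u$ and $\varphi$ in $H^1_0(\mathbb S^d_+)$ for the Dirichlet problem and in $H^1(\mathbb S^d_+)$ for the Neumann problem. Let $|\mathbb S^d_+|$ and $|\partial\mathbb S^d_+|$ be the $d$-dimensional measure of the hemisphere and the $(d-1)$-dimensional measure of its boundary, let $$L^{class}_{0,k}=\frac{(4\pi)^{-k/2}}{\Gamma(1+k/2)},\qquad \psi(\eta)=\eta-\lfloor\eta\rfloor-\tfrac12\quad(\eta\ge0),$$ and for $z\ge 0$ let $w=w(z)\ge0$ be defined by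 $w(w+d-1)=z$. Then $N^D(z)$ and $N^N(z)$ are finite for every $z$, and as $z\to+\infty$ the following hold. (i) (Dirichlet) $$\frac{N^D(z)}{L^{class}_{0,d}|\mathbb S^d_+|\,z^{d/2}}=1-\frac14\,\frac{L^{class}_{0,d-1}}{L^{class}_{0,d}}\,\frac{|\partial\mathbb S^d_+|}{|\mathbb S^d_+|}\,(1+2\psi(w))\,z^{-1/2}+\frac{d(d-1)}{2}\left(\Big(\frac12+\psi(w)\Big)^2+\frac{d-2}{6}\right)z^{-1}+O(z^{-3/2}),$$ or, equivalently, $$\frac{N^D(z)}{L^{class}_{0,d}|\mathbb S^d_+|\,z^{d/2}}=1-\frac{d(1+2\psi(w))}{2}\,z^{-1/2}+\frac{d(d-1)}{2}\left(\Big(\frac12+\psi(w)\Big)^2+\frac{d-2}{6}\right)z^{-1}+O(z^{-3/2}).$$ (ii) (Neumann) $$\frac{N^N(z)}{L^{class}_{0,d}|\mathbb S^d_+|\,z^{d/2}}=1+\frac14\,\frac{L^{class}_{0,d-1}}{L^{class}_{0,d}}\,\frac{|\partial\mathbb S^d_+|}{|\mathbb S^d_+|}\,(1-2\psi(w))\,z^{-1/2}+\frac{d(d-1)}{2}\left(\Big(\frac12-\psi(w)\Big)^2+\frac{d-2}{6}\right)z^{-1}+O(z^{-3/2}),$$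 or, equivalently, $$\frac{N^N(z)}{L^{class}_{0,d}|\mathbb S^d_+|\,z^{d/2}}=1+\frac{d(1-2\psi(w))}{2}\,z^{-1/2}+\frac{d(d-1)}{2}\left(\Big(\frac12-\psi(w)\Big)^2+\frac{d-2}{6}\right)z^{-1}+O(z^{-3/2}).$$ -/

import Mathlib

open scoped ContDiff ENNReal RealInnerProductSpace

noncomputable section

/-- The Euclidean space `ℝⁿ`. -/
abbrev Eucl (n : ℕ) : Type := EuclideanSpace ℝ (Fin n)

/-- The unit sphere `S^d` in `ℝ^{d+1}`. -/
abbrev Sph (d : ℕ) : Type := Metric.sphere (0 : Eucl (d + 1)) 1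

/-- The open half-space `x_{d+1} > 0` of `ℝ^{d+1}`. -/
def upperHalfSpace (d : ℕ) : Set (Eucl (d + 1)) := {x | 0 < x (Fin.last d)}

/-- The open hemisphere `S^d_+`. -/
def hemisphere (d : ℕ) : Set (Sph d) := {x | (x : Eucl (d + 1)) ∈ upperHalfSpace d}

/-- The surface measure on the hemisphere `S^d_+`. -/
def hemiMeasure (d : ℕ) : MeasureTheory.Measure (Sph d) :=
  ((MeasureTheory.volume : MeasureTheory.Measure (Eucl (d + 1))).toSphere).restrict (hemisphere d)

instance hemiMeasure_isFinite (d : ℕ) : MeasureTheory.IsFiniteMeasure (hemiMeasure d) := by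
  unfold hemiMeasure; infer_instance

/-- `|S^d_+|`. -/
def hemiArea (d : ℕ) : ℝ := (hemiMeasure d).real Set.univ

/-- `|∂S^d_+|`, the `(d-1)`-dimensional surface area of the equator `{x ∈ S^d : x_{d+1} = 0}`;
dropping the last coordinate identifies the equator isometrically with the unit sphere of `ℝ^d`. -/
def equatorArea (d : ℕ) : ℝ :=
  ((MeasureTheory.volume : MeasureTheory.Measure (Eucl d)).toSphere).real Set.univ

/-- The semiclassical constant `L^{class}_{γ,δ}`, where `δ` is the dimension. -/
def semiclassicalConst (γ δ : ℝ) : ℝ :=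
  (4 * Real.pi) ^ (-(δ / 2)) * Real.Gamma (γ + 1) / Real.Gamma (γ + 1 + δ / 2)

/-- The fluctuation function. -/
def fluct (η : ℝ) : ℝ := η - (⌊η⌋ : ℝ) - 1 / 2

/-- Real-valued `L²(S^d_+)`. -/
abbrev HemiL2 (d : ℕ) : Type := MeasureTheory.Lp ℝ 2 (hemiMeasure d)

/-- `ℝ^{d+1}`-valued `L²(S^d_+)`, which contains the square integrable tangent fields. -/
abbrev HemiL2Vec (d : ℕ) : Type := MeasureTheory.Lp (Eucl (d + 1)) 2 (hemiMeasure d)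

/-- The Riemannian gradient on the unit sphere, at a point `x` of the sphere, of the restriction
of `f`: the tangential part of the Euclidean gradient. -/
def sphGrad {d : ℕ} (f : Eucl (d + 1) → ℝ) (x : Eucl (d + 1)) : Eucl (d + 1) :=
  gradient f x - ⟪gradient f x, x⟫ • x

/-- The Riemannian divergence on the unit sphere, at a point `x` of the sphere, of a field `X`
that is tangent to the sphere: the trace of `DX(x)` over the tangent space at `x`. -/
def sphDiv {d : ℕ} (X : Eucl (d + 1) → Eucl (d + 1)) (x : Eucl (d + 1)) : ℝ :=
  (∑ i, (fderiv ℝ X x (EuclideanSpace.single i 1)) i) - ⟪fderiv ℝ X x x, x⟫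

/-- `f` is smooth on `ℝ^{d+1}` with compact support in the open half-space. The restrictions of
such functions to the sphere are exactly the elements of `C_c^∞(S^d_+)` (and likewise for
vector-valued functions). -/
def IsTest {d : ℕ} {F : Type*} [NormedAddCommGroup F] [NormedSpace ℝ F]
    (f : Eucl (d + 1) → F) : Prop :=
  ContDiff ℝ ∞ f ∧ HasCompactSupport f ∧ tsupport f ⊆ upperHalfSpace d

/-- `X` restricts to a smooth compactly supported tangent vector field on `S^d_+`. -/
def IsTestField {d : ℕ} (X : Eucl (d + 1) → Eucl (d + 1)) : Prop :=
  IsTest X ∧ ∀ x : Sph d, ⟪X x, (x : Eucl (d + 1))⟫ = 0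

/-- `G` is the weak gradient of `u` on `S^d_+`: it is tangent to the sphere, and
`∫ u div X = - ∫ G · X` for all smooth compactly supported tangent vector fields `X`. -/
def IsWeakGrad {d : ℕ} (u : HemiL2 d) (G : HemiL2Vec d) : Prop :=
  (∀ᵐ x ∂(hemiMeasure d), ⟪G x, (x : Eucl (d + 1))⟫ = 0) ∧
  ∀ X : Eucl (d + 1) → Eucl (d + 1), IsTestField X →
    ∫ x, u x * sphDiv X x ∂(hemiMeasure d) = - ∫ x, ⟪G x, X x⟫ ∂(hemiMeasure d)

theorem continuous_sphDiv {d : ℕ} {X : Eucl (d + 1) → Eucl (d + 1)} (hX : ContDiff ℝ ∞ X) :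
    Continuous (sphDiv X) := by
  have h : Continuous (fderiv ℝ X) := hX.continuous_fderiv (by simp)
  unfold sphDiv
  refine Continuous.sub ?_ ?_
  · refine continuous_finsetSum _ fun i _ => ?_
    have h1 : Continuous fun x => fderiv ℝ X x (EuclideanSpace.single i 1) :=
      h.clm_apply continuous_const
    fun_prop
  · exact (h.clm_apply continuous_id).inner continuous_id

theorem integrable_mul_sphDiv {d : ℕ} (u : HemiL2 d) {X : Eucl (d + 1) → Eucl (d + 1)}
    (hX : ContDiff ℝ ∞ X) :
    MeasureTheory.Integrable (fun x => u x * sphDiv X x) (hemiMeasure d) := by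
  have hu : MeasureTheory.Integrable u (hemiMeasure d) :=
    (MeasureTheory.Lp.memLp u).integrable (by norm_num)
  have hc : Continuous fun x : Sph d => sphDiv X x :=
    (continuous_sphDiv hX).comp continuous_subtype_val
  obtain ⟨C, hC⟩ := isCompact_univ.exists_bound_of_continuousOn hc.continuousOn
  exact hu.mul_bdd (c := C) hc.aestronglyMeasurable (Filter.Eventually.of_forall fun x => hC x trivial)

theorem integrable_inner_field {d : ℕ} (G : HemiL2Vec d) {X : Eucl (d + 1) → Eucl (d + 1)}
    (hX : Continuous X) :
    MeasureTheory.Integrable (fun x : Sph d => ⟪G x, X x⟫) (hemiMeasure d) := by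
  have hG : MeasureTheory.Integrable G (hemiMeasure d) :=
    (MeasureTheory.Lp.memLp G).integrable (by norm_num)
  have hc : Continuous fun x : Sph d => X x := hX.comp continuous_subtype_val
  obtain ⟨C, hC⟩ := isCompact_univ.exists_bound_of_continuousOn hc.continuousOn
  refine (hG.norm.mul_const C).mono' (hG.1.inner hc.aestronglyMeasurable)
    (Filter.Eventually.of_forall fun x => ?_)
  exact (norm_inner_le_norm _ _).trans
    (mul_le_mul_of_nonneg_left (hC x trivial) (norm_nonneg _))

/-- The Sobolev space `H¹(S^d_+)`: functions in `L²` with weak gradient in `L²`. An element `u` is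
recorded as the pair `(u, ∇u)`. -/
def sobolevH1 (d : ℕ) : Submodule ℝ (HemiL2 d × HemiL2Vec d) where
  carrier := {p | IsWeakGrad p.1 p.2}
  zero_mem' := by
    refine ⟨?_, fun X _ => ?_⟩
    · filter_upwards [MeasureTheory.Lp.coeFn_zero (Eucl (d + 1)) 2 (hemiMeasure d)] with x hx
      rw [Prod.snd_zero, hx, Pi.zero_apply, inner_zero_left]
    · have h1 : ∫ x, (0 : HemiL2 d) x * sphDiv X x ∂(hemiMeasure d) = 0 := by
        refine MeasureTheory.integral_eq_zero_of_ae ?_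
        filter_upwards [MeasureTheory.Lp.coeFn_zero ℝ 2 (hemiMeasure d)] with x hx
        rw [hx, Pi.zero_apply, zero_mul]
      have h2 : ∫ x, ⟪(0 : HemiL2Vec d) x, X x⟫ ∂(hemiMeasure d) = 0 := by
        refine MeasureTheory.integral_eq_zero_of_ae ?_
        filter_upwards [MeasureTheory.Lp.coeFn_zero (Eucl (d + 1)) 2 (hemiMeasure d)] with x hx
        rw [hx, Pi.zero_apply, Pi.zero_apply, inner_zero_left]
      simp only [Prod.fst_zero, Prod.snd_zero, h1, h2, neg_zero]
  add_mem' := by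
    rintro ⟨u, G⟩ ⟨v, K⟩ ⟨h1, h2⟩ ⟨k1, k2⟩
    refine ⟨?_, fun X hX => ?_⟩
    · filter_upwards [h1, k1, MeasureTheory.Lp.coeFn_add G K] with x hx kx hs
      simp only [Prod.mk_add_mk, hs, Pi.add_apply, inner_add_left]
      rw [hx, kx, add_zero]
    · have e1 : ∫ x, (u + v) x * sphDiv X x ∂(hemiMeasure d)
          = ∫ x, (u x * sphDiv X x + v x * sphDiv X x) ∂(hemiMeasure d) := by
        refine MeasureTheory.integral_congr_ae ?_
        filter_upwards [MeasureTheory.Lp.coeFn_add u v] with x hx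
        rw [hx, Pi.add_apply, add_mul]
      have e2 : ∫ x, ⟪(G + K) x, X x⟫ ∂(hemiMeasure d)
          = ∫ x, (⟪G x, X x⟫ + ⟪K x, X x⟫) ∂(hemiMeasure d) := by
        refine MeasureTheory.integral_congr_ae ?_
        filter_upwards [MeasureTheory.Lp.coeFn_add G K] with x hx
        rw [hx, Pi.add_apply, inner_add_left]
      have hX1 := hX.1.1
      have a := h2 X hX
      have b := k2 X hX
      simp only at a b
      simp only [Prod.mk_add_mk]
      rw [e1, e2, MeasureTheory.integral_add (integrable_mul_sphDiv u hX1)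
        (integrable_mul_sphDiv v hX1), MeasureTheory.integral_add
        (integrable_inner_field G hX1.continuous) (integrable_inner_field K hX1.continuous), a, b]
      ring
  smul_mem' := by
    rintro c ⟨u, G⟩ ⟨h1, h2⟩
    refine ⟨?_, fun X hX => ?_⟩
    · filter_upwards [h1, MeasureTheory.Lp.coeFn_smul c G] with x hx hs
      simp only [Prod.smul_mk, hs, Pi.smul_apply, real_inner_smul_left]
      rw [hx, mul_zero]
    · have e1 : ∫ x, (c • u) x * sphDiv X x ∂(hemiMeasure d)
          = ∫ x, c * (u x * sphDiv X x) ∂(hemiMeasure d) := by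
        refine MeasureTheory.integral_congr_ae ?_
        filter_upwards [MeasureTheory.Lp.coeFn_smul c u] with x hx
        rw [hx, Pi.smul_apply, smul_eq_mul, mul_assoc]
      have e2 : ∫ x, ⟪(c • G) x, X x⟫ ∂(hemiMeasure d)
          = ∫ x, c * ⟪G x, X x⟫ ∂(hemiMeasure d) := by
        refine MeasureTheory.integral_congr_ae ?_
        filter_upwards [MeasureTheory.Lp.coeFn_smul c G] with x hx
        rw [hx, Pi.smul_apply, real_inner_smul_left]
      have a := h2 X hX
      simp only at a
      simp only [Prod.smul_mk]
      rw [e1, e2, MeasureTheory.integral_const_mul, MeasureTheory.integral_const_mul, a]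
      ring

theorem IsTest.differentiable {d : ℕ} {f : Eucl (d + 1) → ℝ} (hf : IsTest f) :
    Differentiable ℝ f := hf.1.differentiable (by simp)

theorem sphGrad_add {d : ℕ} {f g : Eucl (d + 1) → ℝ} (hf : IsTest f) (hg : IsTest g)
    (x : Eucl (d + 1)) : sphGrad (f + g) x = sphGrad f x + sphGrad g x := by
  have h : gradient (f + g) x = gradient f x + gradient g x := by
    unfold gradient
    rw [fderiv_add (hf.differentiable x) (hg.differentiable x), map_add]
  unfold sphGrad
  rw [h, inner_add_left, add_smul]
  abel

theorem sphGrad_smul {d : ℕ} (c : ℝ) {f : Eucl (d + 1) → ℝ} (hf : IsTest f)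
    (x : Eucl (d + 1)) : sphGrad (c • f) x = c • sphGrad f x := by
  have h : gradient (c • f) x = c • gradient f x := by
    unfold gradient
    rw [fderiv_const_smul (hf.differentiable x), map_smulₛₗ]
    simp
  unfold sphGrad
  rw [h, real_inner_smul_left, smul_sub, smul_smul]

/-- The pairs `(φ, ∇φ)` for `φ ∈ C_c^∞(S^d_+)`. -/
def testGraph (d : ℕ) : Submodule ℝ (HemiL2 d × HemiL2Vec d) where
  carrier := {p | ∃ f : Eucl (d + 1) → ℝ, IsTest f ∧
    (∀ᵐ x ∂(hemiMeasure d), p.1 x = f x) ∧ ∀ᵐ x ∂(hemiMeasure d), p.2 x = sphGrad f x}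
  zero_mem' := by
    refine ⟨0, ⟨contDiff_const, HasCompactSupport.zero, ?_⟩, ?_, ?_⟩
    · simp [tsupport]
    · exact MeasureTheory.Lp.coeFn_zero ℝ 2 (hemiMeasure d)
    · filter_upwards [MeasureTheory.Lp.coeFn_zero (Eucl (d + 1)) 2 (hemiMeasure d)] with x hx
      rw [Prod.snd_zero, hx]
      simp [sphGrad, gradient]
  add_mem' := by
    rintro ⟨u, G⟩ ⟨v, K⟩ ⟨f, hf, f1, f2⟩ ⟨g, hg, g1, g2⟩
    refine ⟨f + g, ⟨hf.1.add hg.1, hf.2.1.add hg.2.1,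
      (tsupport_add f g).trans (Set.union_subset hf.2.2 hg.2.2)⟩, ?_, ?_⟩
    · filter_upwards [f1, g1, MeasureTheory.Lp.coeFn_add u v] with x hx kx hs
      simp only [Prod.mk_add_mk, hs, Pi.add_apply, hx, kx]
    · filter_upwards [f2, g2, MeasureTheory.Lp.coeFn_add G K] with x hx kx hs
      simp only [Prod.mk_add_mk, hs, Pi.add_apply, hx, kx, sphGrad_add hf hg]
  smul_mem' := by
    rintro c ⟨u, G⟩ ⟨f, hf, f1, f2⟩
    refine ⟨c • f, ⟨hf.1.const_smul c, hf.2.1.smul_left (f := fun _ => c),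
      (tsupport_smul_subset_right (fun _ => c) f).trans hf.2.2⟩, ?_, ?_⟩
    · filter_upwards [f1, MeasureTheory.Lp.coeFn_smul c u] with x hx hs
      simp only [Prod.smul_mk, hs, Pi.smul_apply, hx]
    · filter_upwards [f2, MeasureTheory.Lp.coeFn_smul c G] with x hx hs
      simp only [Prod.smul_mk, hs, Pi.smul_apply, hx, sphGrad_smul c hf]

/-- The Sobolev space `H¹_0(S^d_+)`: the closure of `C_c^∞(S^d_+)` for the norm of `H¹`, that is,
for convergence of `u` and of `∇u` in `L²`. An element `u` is recorded as the pair `(u, ∇u)`. -/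
def sobolevH10 (d : ℕ) : Submodule ℝ (HemiL2 d × HemiL2Vec d) :=
  (testGraph d).topologicalClosure

/-- The pairs `(u, ∇u)` in `V` with `∫ ∇u · ∇φ = lam ∫ u φ` for all `(φ, ∇φ)` in `V`. -/
def weakSolutions {d : ℕ} (V : Submodule ℝ (HemiL2 d × HemiL2Vec d)) (lam : ℝ) :
    Submodule ℝ (HemiL2 d × HemiL2Vec d) where
  carrier := {p | p ∈ V ∧ ∀ q ∈ V, ⟪p.2, q.2⟫ = lam * ⟪p.1, q.1⟫}
  zero_mem' := ⟨V.zero_mem, fun q _ => by simp⟩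
  add_mem' := fun {p r} hp hr => ⟨V.add_mem hp.1 hr.1, fun q hq => by
    rw [Prod.snd_add, Prod.fst_add, inner_add_left, inner_add_left, hp.2 q hq, hr.2 q hq, mul_add]⟩
  smul_mem' := fun c p hp => ⟨V.smul_mem c hp.1, fun q hq => by
    rw [Prod.smul_snd, Prod.smul_fst, real_inner_smul_left, real_inner_smul_left, hp.2 q hq]
    ring⟩

/-- The eigenspace for `lam`, in `L²(S^d_+)`, of the Laplacian with form domain `V`; the number
`lam` is an eigenvalue when it is nonzero, and its multiplicity is its dimension. -/
def weakEigenspace {d : ℕ} (V : Submodule ℝ (HemiL2 d × HemiL2Vec d)) (lam : ℝ) :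
    Submodule ℝ (HemiL2 d) :=
  (weakSolutions V lam).map (LinearMap.fst ℝ (HemiL2 d) (HemiL2Vec d))

/-- The number of eigenvalues `≤ z`, counted with multiplicity, possibly infinite. -/
def eigenCount {d : ℕ} (V : Submodule ℝ (HemiL2 d × HemiL2Vec d)) (z : ℝ) : ℝ≥0∞ :=
  ∑' lam : Set.Iic z, ((Cardinal.toENat (Module.rank ℝ (weakEigenspace V (lam : ℝ))) : ℕ∞) : ℝ≥0∞)

/-- The counting function `N^D` of the Dirichlet Laplacian on `S^d_+`. -/
def countDirichlet (d : ℕ) (z : ℝ) : ℝ≥0∞ := eigenCount (sobolevH10 d) z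

/-- The counting function `N^N` of the Neumann Laplacian on `S^d_+`. -/
def countNeumann (d : ℕ) (z : ℝ) : ℝ≥0∞ := eigenCount (sobolevH1 d) z

end

/-! On the hemisphere a function x_{d+1}^s q(x_1, …, x_d) satisfies the Neumann condition at the
equator when s = 0 and the Dirichlet condition when s = 1. On such functions -Δ becomes an operator
on polynomials q in d variables: on degree k it is multiplication by (k+s)(k+s+d-1) minus the
Euclidean Laplacian, which lowers the degree by 2 (`sphereOperator_hemiLift`,
`reducedLap_of_isHomogeneous`). This operator is triangular with distinct diagonal entries, so every
homogeneous p of degree k is the top part of an eigenfunction. The multiplicity is therefore the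
dimension C(k+d-1, d-1) of the space of such p.

The divergence theorem on the sphere, with cutoffs near the equator, shows that these functions are
weak eigenfunctions in the right form domain (`eigenPoly_mem_weakSolutions`). Nothing else is in the
spectrum. The hemisphere is a graph over the unit ball, so by Stone–Weierstrass these functions are
total in L² (`eq_zero_of_orthogonal_eigenPoly`), and weak eigenfunctions for different eigenvalues
are orthogonal (`inner_eigenMap_of_ne`). Neither traces nor a compact embedding are needed.

Summing multiplicities gives N(z) = C(⌊w⌋-s+d, d) (`eigenCount_eq_choose`), a product of d linear
factors in ⌊w⌋ = w - 1/2 - ψ(w), divided by d!. Since (w+(d-1)/2)² = z + (d-1)²/4, each factor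
expands in powers of z^{-1/2}, and so does the product (`isBigO_prod_expansion`). The Weyl constant
is 1/d! (`semiclassicalConst_mul_hemiArea`). -/

noncomputable section

namespace HemisphereWeyl

open MvPolynomial

/-! ### Eigenpolynomials of the reduced Laplacian in d variables. -/

/-- The Laplacian on polynomials. -/
def polyLap (σ : Type*) [Fintype σ] : MvPolynomial σ ℝ →ₗ[ℝ] MvPolynomial σ ℝ :=
  ∑ i, (pderiv i).toLinearMap ∘ₗ (pderiv i).toLinearMap

/-- The Euler operator `∑ Xᵢ ∂ᵢ` on polynomials. -/
def polyEuler (σ : Type*) [Fintype σ] : MvPolynomial σ ℝ →ₗ[ℝ] MvPolynomial σ ℝ :=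
  ∑ i, (LinearMap.mulLeft ℝ (X i)) ∘ₗ (pderiv i).toLinearMap

variable {σ : Type*} [Fintype σ]

theorem polyLap_apply (p : MvPolynomial σ ℝ) : polyLap σ p = ∑ i, pderiv i (pderiv i p) := by
  simp [polyLap]

theorem polyEuler_apply (p : MvPolynomial σ ℝ) : polyEuler σ p = ∑ i, X i * pderiv i p := by
  simp [polyEuler]

theorem polyEuler_of_isHomogeneous {p : MvPolynomial σ ℝ} {k : ℕ} (hp : p.IsHomogeneous k) :
    polyEuler σ p = (k : ℝ) • p := by
  rw [polyEuler_apply, hp.sum_X_mul_pderiv, ← Nat.cast_smul_eq_nsmul ℝ]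

theorem isHomogeneous_polyLap {p : MvPolynomial σ ℝ} {k : ℕ} (hp : p.IsHomogeneous k) :
    (polyLap σ p).IsHomogeneous (k - 2) := by
  rw [polyLap_apply]
  exact IsHomogeneous.sum _ _ _ fun i _ => hp.pderiv.pderiv

theorem polyLap_eq_zero_of_isHomogeneous {p : MvPolynomial σ ℝ} {k : ℕ} (hp : p.IsHomogeneous k)
    (hk : k < 2) : polyLap σ p = 0 := by
  rw [polyLap_apply]
  refine Finset.sum_eq_zero fun i _ => ?_
  have h : (pderiv i p).IsHomogeneous 0 := by
    have := hp.pderiv (i := i)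
    rwa [show k - 1 = 0 by omega] at this
  rw [(totalDegree_eq_zero_iff_eq_C.1 ((totalDegree_zero_iff_isHomogeneous _).2 h)), pderiv_C]

theorem isHomogeneous_polyLap_pow {p : MvPolynomial σ ℝ} {k : ℕ} (hp : p.IsHomogeneous k) (j : ℕ) :
    ((polyLap σ ^ j) p).IsHomogeneous (k - 2 * j) := by
  induction j with
  | zero => simpa using hp
  | succ j ih =>
    rw [pow_succ', Module.End.mul_apply, show k - 2 * (j + 1) = k - 2 * j - 2 by omega]
    exact isHomogeneous_polyLap ih

/-- The degree `k - 2 * j` is a truncated subtraction, so homogeneity alone says nothing once 2j >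
k; this vanishing covers that range. -/
theorem polyLap_pow_eq_zero {p : MvPolynomial σ ℝ} {k : ℕ} (hp : p.IsHomogeneous k) {j : ℕ}
    (hj : k < 2 * j) : (polyLap σ ^ j) p = 0 := by
  obtain ⟨j, rfl⟩ : ∃ i, j = i + 1 := ⟨j - 1, by omega⟩
  rw [pow_succ', Module.End.mul_apply]
  by_cases h : k < 2 * j
  · have h0 := isHomogeneous_polyLap_pow hp j
    exact polyLap_eq_zero_of_isHomogeneous h0 (by omega)
  · exact polyLap_eq_zero_of_isHomogeneous (isHomogeneous_polyLap_pow hp j) (by omega)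

/-- The eigenvalues `(k + s) (k + s + d - 1)`. -/
def hemiEigenvalue (d s k : ℕ) : ℝ := ((k : ℝ) + s) * (k + s + d - 1)

theorem hemiEigenvalue_strictMono {d : ℕ} (hd : 1 ≤ d) (s : ℕ) :
    StrictMono (hemiEigenvalue d s) := by
  refine strictMono_nat_of_lt_succ fun k => ?_
  have h : (1 : ℝ) ≤ d := by exact_mod_cast hd
  unfold hemiEigenvalue
  push_cast
  have : (0 : ℝ) ≤ k := k.cast_nonneg
  have : (0 : ℝ) ≤ s := s.cast_nonneg
  nlinarith

/-- The coefficients of the eigenfunction with a given leading part. -/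
def eigenCoeff (d s k : ℕ) : ℕ → ℝ
  | 0 => 1
  -- Chosen so that the terms of degree k - 2(j+1) cancel in the eigenvalue equation. When 2(j+1) >
  -- k the value is irrelevant, because it multiplies a zero power of the Laplacian.
  | j + 1 => eigenCoeff d s k j / (hemiEigenvalue d s (k - 2 * (j + 1)) - hemiEigenvalue d s k)

/-- The polynomial with leading part `p`, homogeneous of degree `k`, whose `s`-lift is an
eigenfunction of the spherical Laplacian. -/
def eigenPoly (d s k : ℕ) : MvPolynomial (Fin d) ℝ →ₗ[ℝ] MvPolynomial (Fin d) ℝ :=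
  ∑ j ∈ Finset.range (k + 1), eigenCoeff d s k j • polyLap (Fin d) ^ j

/-- The operator through which the spherical Laplacian acts on `s`-lifts. -/
def reducedLap (d s : ℕ) : MvPolynomial (Fin d) ℝ →ₗ[ℝ] MvPolynomial (Fin d) ℝ :=
  polyEuler (Fin d) ∘ₗ polyEuler (Fin d) + (2 * s + d - 1 : ℝ) • polyEuler (Fin d)
    + (s * (s + d - 1) : ℝ) • LinearMap.id - polyLap (Fin d)

theorem eigenPoly_apply (d s k : ℕ) (p : MvPolynomial (Fin d) ℝ) :
    eigenPoly d s k p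
      = ∑ j ∈ Finset.range (k + 1), eigenCoeff d s k j • (polyLap (Fin d) ^ j) p := by
  simp [eigenPoly, LinearMap.sum_apply]

theorem reducedLap_of_isHomogeneous {d s k : ℕ} {p : MvPolynomial (Fin d) ℝ}
    (hp : p.IsHomogeneous k) :
    reducedLap d s p = hemiEigenvalue d s k • p - polyLap (Fin d) p := by
  simp only [reducedLap, LinearMap.sub_apply, LinearMap.add_apply, LinearMap.comp_apply,
    LinearMap.smul_apply, LinearMap.id_apply, polyEuler_of_isHomogeneous hp, map_smul,
    smul_smul, ← add_smul]
  congr 2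
  unfold hemiEigenvalue
  ring

theorem reducedLap_polyLap_pow {d s k : ℕ} {p : MvPolynomial (Fin d) ℝ}
    (hp : p.IsHomogeneous k) (j : ℕ) :
    reducedLap d s ((polyLap (Fin d) ^ j) p)
      = hemiEigenvalue d s (k - 2 * j) • (polyLap (Fin d) ^ j) p
        - (polyLap (Fin d) ^ (j + 1)) p := by
  rw [reducedLap_of_isHomogeneous (isHomogeneous_polyLap_pow hp j), pow_succ',
    Module.End.mul_apply]

/-- The operator is diagonal minus Δ on homogeneous pieces, so the diagonal defect of the term j+1
cancels the Laplacian of the term j. -/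
theorem reducedLap_eigenPoly {d s k : ℕ} (hd : 1 ≤ d) {p : MvPolynomial (Fin d) ℝ}
    (hp : p.IsHomogeneous k) :
    reducedLap d s (eigenPoly d s k p) = hemiEigenvalue d s k • eigenPoly d s k p := by
  rw [← sub_eq_zero, eigenPoly_apply, map_sum, Finset.smul_sum, ← Finset.sum_sub_distrib]
  have h1 : ∀ j ∈ Finset.range (k + 1),
      reducedLap d s (eigenCoeff d s k j • (polyLap (Fin d) ^ j) p)
        - hemiEigenvalue d s k • eigenCoeff d s k j • (polyLap (Fin d) ^ j) p
      = (eigenCoeff d s k j * (hemiEigenvalue d s (k - 2 * j) - hemiEigenvalue d s k))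
          • (polyLap (Fin d) ^ j) p
        - eigenCoeff d s k j • (polyLap (Fin d) ^ (j + 1)) p := fun j _ => by
    rw [map_smul, reducedLap_polyLap_pow hp]
    module
  -- The diagonal sum loses its term j = 0, where the two eigenvalues coincide, and the other sum
  -- loses its last term by degree; the shifted sums then match term by term.
  rw [Finset.sum_congr rfl h1, Finset.sum_sub_distrib, Finset.sum_range_succ',
    Finset.sum_range_succ, polyLap_pow_eq_zero hp (j := k + 1) (by omega)]
  simp only [mul_zero, Nat.sub_zero, sub_self, zero_smul, add_zero, smul_zero]
  rw [← Finset.sum_sub_distrib]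
  refine Finset.sum_eq_zero fun j _ => ?_
  rw [sub_eq_zero]
  by_cases hj : k < 2 * (j + 1)
  · rw [polyLap_pow_eq_zero hp hj, smul_zero, smul_zero]
  · congr 1
    rw [eigenCoeff, div_mul_cancel₀]
    have := hemiEigenvalue_strictMono hd s (show k - 2 * (j + 1) < k by omega)
    linarith

theorem eigenPoly_eq_self_add (d s k : ℕ) (p : MvPolynomial (Fin d) ℝ) :
    eigenPoly d s k p = p + ∑ j ∈ Finset.range k,
      eigenCoeff d s k (j + 1) • (polyLap (Fin d) ^ (j + 1)) p := by
  rw [eigenPoly_apply, Finset.sum_range_succ', add_comm]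
  simp [eigenCoeff]

theorem homogeneousComponent_eigenPoly {d s k : ℕ} {p : MvPolynomial (Fin d) ℝ}
    (hp : p.IsHomogeneous k) : homogeneousComponent k (eigenPoly d s k p) = p := by
  rw [eigenPoly_eq_self_add, map_add, map_sum, homogeneousComponent_eq_self hp,
    Finset.sum_eq_zero, add_zero]
  intro j _
  rw [map_smul]
  by_cases hj : k < 2 * (j + 1)
  · rw [polyLap_pow_eq_zero hp hj, map_zero, smul_zero]
  · rw [homogeneousComponent_of_mem (isHomogeneous_polyLap_pow hp (j + 1)), if_neg (by omega),
      smul_zero]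

/-- Eigenpolynomials are their leading parts plus terms of lower degree, so by induction on the
degree they span all polynomials. The dual form is the one applied to Λ = ⟪·, u⟫. -/
theorem eq_zero_of_eigenPoly {d s : ℕ} {Λ : MvPolynomial (Fin d) ℝ →ₗ[ℝ] ℝ}
    (h : ∀ k p, p.IsHomogeneous k → Λ (eigenPoly d s k p) = 0) : Λ = 0 := by
  have key : ∀ k, ∀ p : MvPolynomial (Fin d) ℝ, p.IsHomogeneous k → Λ p = 0 := by
    intro k
    induction k using Nat.strong_induction_on with
    | _ k ih =>
      intro p hp
      have h1 := h k p hp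
      rw [eigenPoly_eq_self_add, map_add, map_sum, Finset.sum_eq_zero, add_zero] at h1
      · exact h1
      · intro j _
        rw [map_smul]
        by_cases hj : k < 2 * (j + 1)
        · rw [polyLap_pow_eq_zero hp hj, map_zero, smul_zero]
        · rw [ih _ (by omega) _ (isHomogeneous_polyLap_pow hp (j + 1)), smul_zero]
  refine LinearMap.ext fun p => ?_
  rw [← sum_homogeneousComponent p, map_sum]
  exact Finset.sum_eq_zero fun k _ => key k _ (homogeneousComponent_isHomogeneous k p)

theorem finrank_homogeneousSubmodule (n k : ℕ) :
    Module.finrank ℝ (homogeneousSubmodule (Fin (n + 1)) ℝ k) = (k + n).choose n := by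
  classical
  rw [homogeneousSubmodule_eq_finsupp_supported]
  have hS : {m : Fin (n + 1) →₀ ℕ | m.degree = k}
      = ↑(Finset.finsuppAntidiag (Finset.univ : Finset (Fin (n + 1))) k) := by
    ext m
    simp [Finset.mem_finsuppAntidiag, Finsupp.degree_eq_sum]
  rw [hS, (AddMonoidAlgebra.supportedEquivFinsupp _).finrank_eq, Module.finrank_finsupp_self]
  rw [← Nat.card_eq_fintype_card, Nat.card_coe_set_eq, Set.ncard_coe_finset, Finset.card_finsuppAntidiag_nat_eq_choose, Finset.card_univ,
    Fintype.card_fin, show n + 1 + k - 1 = k + n by omega, Nat.choose_symm_add]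

end HemisphereWeyl
end

/-! ### Lifts to d+1 variables. -/

noncomputable section

namespace HemisphereWeyl

open MvPolynomial

section Algebra

theorem polyEuler_mul {σ : Type*} [Fintype σ] (p q : MvPolynomial σ ℝ) :
    polyEuler σ (p * q) = polyEuler σ p * q + p * polyEuler σ q := by
  simp only [polyEuler_apply, pderiv_mul, Finset.sum_mul, Finset.mul_sum,
    ← Finset.sum_add_distrib]
  exact Finset.sum_congr rfl fun i _ => by ring

theorem polyEuler_X {σ : Type*} [Fintype σ] (i : σ) : polyEuler σ (X i) = X i := by
  simpa using polyEuler_of_isHomogeneous (isHomogeneous_X ℝ i)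

/-- The polynomial `x_{d+1}^s p(x_1, …, x_d)`. -/
def hemiLift (d s : ℕ) : MvPolynomial (Fin d) ℝ →ₗ[ℝ] MvPolynomial (Fin (d + 1)) ℝ :=
  LinearMap.mulLeft ℝ (X (Fin.last d) ^ s) ∘ₗ (rename Fin.castSucc).toLinearMap

variable {d : ℕ}

theorem hemiLift_apply (s : ℕ) (p : MvPolynomial (Fin d) ℝ) :
    hemiLift d s p = X (Fin.last d) ^ s * rename Fin.castSucc p := rfl

theorem pderiv_last_rename (p : MvPolynomial (Fin d) ℝ) :
    pderiv (Fin.last d) (rename Fin.castSucc p) = 0 := by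
  classical
  refine pderiv_eq_zero_of_notMem_vars fun h => ?_
  obtain ⟨i, -, hi⟩ := Finset.mem_image.1 (vars_rename _ _ h)
  exact (Fin.castSucc_lt_last i).ne hi

theorem pderiv_castSucc_hemiLift (s : ℕ) (p : MvPolynomial (Fin d) ℝ) (i : Fin d) :
    pderiv i.castSucc (hemiLift d s p) = hemiLift d s (pderiv i p) := by
  rw [hemiLift_apply, pderiv_mul, pderiv_pow, pderiv_X_of_ne (Fin.castSucc_lt_last i).ne',
    pderiv_rename (Fin.castSucc_injective d), hemiLift_apply]
  ring

theorem pderiv_last_hemiLift (s : ℕ) (p : MvPolynomial (Fin d) ℝ) :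
    pderiv (Fin.last d) (hemiLift d s p)
      = (s : MvPolynomial (Fin (d + 1)) ℝ) * X (Fin.last d) ^ (s - 1)
        * rename Fin.castSucc p := by
  rw [hemiLift_apply, pderiv_mul, pderiv_pow, pderiv_X_self, pderiv_last_rename]
  ring

/-- For s ≤ 1 the factor x_{d+1}^s has zero second derivative, so the Laplacian sees only the
tangential variables. -/
theorem polyLap_hemiLift {s : ℕ} (hs : s ≤ 1) (p : MvPolynomial (Fin d) ℝ) :
    polyLap (Fin (d + 1)) (hemiLift d s p) = hemiLift d s (polyLap (Fin d) p) := by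
  have h : pderiv (Fin.last d) (pderiv (Fin.last d) (hemiLift d s p)) = 0 := by
    rw [pderiv_last_hemiLift]
    interval_cases s
    · simp
    · simp [pderiv_last_rename]
  rw [polyLap_apply, Fin.sum_univ_castSucc, h, add_zero, polyLap_apply, map_sum]
  simp only [pderiv_castSucc_hemiLift]

theorem polyEuler_hemiLift {s : ℕ} (p : MvPolynomial (Fin d) ℝ) :
    polyEuler (Fin (d + 1)) (hemiLift d s p)
      = hemiLift d s (polyEuler (Fin d) p + (s : ℝ) • p) := by
  rw [polyEuler_apply, Fin.sum_univ_castSucc, map_add, polyEuler_apply, map_sum]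
  congr 1
  · refine Finset.sum_congr rfl fun i _ => ?_
    rw [pderiv_castSucc_hemiLift, hemiLift_apply, hemiLift_apply, map_mul, rename_X]
    ring
  · rw [pderiv_last_hemiLift, map_smul, hemiLift_apply, Nat.cast_smul_eq_nsmul, nsmul_eq_mul]
    cases s with
    | zero => simp
    | succ s =>
      rw [Nat.add_sub_cancel]
      ring

/-- The polynomial form of `-Δ` on the unit sphere of `ℝ^{d+1}` acts on lifts through `reducedLap`. -/
theorem sphereOperator_hemiLift {s : ℕ} (hs : s ≤ 1) (p : MvPolynomial (Fin d) ℝ) :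
    polyEuler (Fin (d + 1)) (polyEuler (Fin (d + 1)) (hemiLift d s p))
      + (d - 1 : ℝ) • polyEuler (Fin (d + 1)) (hemiLift d s p)
      - polyLap (Fin (d + 1)) (hemiLift d s p)
    = hemiLift d s (reducedLap d s p) := by
  rw [polyLap_hemiLift hs, polyEuler_hemiLift, polyEuler_hemiLift, ← map_smul, ← map_add,
    ← map_sub]
  congr 1
  simp only [reducedLap, LinearMap.sub_apply, LinearMap.add_apply, LinearMap.comp_apply,
    LinearMap.smul_apply, LinearMap.id_apply, map_add, map_smul]
  module

end Algebra

/-! ### Spherical gradient and divergence of polynomial functions. -/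

section Calculus

variable {n : ℕ}

/-- A polynomial as a function on Euclidean space. -/
def polyFun (Q : MvPolynomial (Fin n) ℝ) (x : Eucl n) : ℝ := eval (fun i => x i) Q

/-- A vector of polynomials as a field on Euclidean space. -/
def polyField (P : Fin n → MvPolynomial (Fin n) ℝ) (x : Eucl n) : Eucl n :=
  WithLp.toLp 2 fun i => polyFun (P i) x

theorem contDiff_polyFun (Q : MvPolynomial (Fin n) ℝ) : ContDiff ℝ ∞ (polyFun Q) := by
  unfold polyFun
  induction Q using MvPolynomial.induction_on with
  | C a => simpa using contDiff_const
  | add p q hp hq => simpa using hp.add hq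
  | mul_X p i hp =>
    have : ContDiff ℝ ∞ fun x : Eucl n => x i := by fun_prop
    simpa using hp.mul this

theorem hasFDerivAt_polyFun (Q : MvPolynomial (Fin n) ℝ) (x : Eucl n) :
    HasFDerivAt (polyFun Q)
      (∑ i, polyFun (pderiv i Q) x • (EuclideanSpace.proj i : Eucl n →L[ℝ] ℝ)) x := by
  classical
  induction Q using MvPolynomial.induction_on with
  | C a =>
    have e : polyFun (C a : MvPolynomial (Fin n) ℝ) = fun _ => a := by
      ext y; simp [polyFun]
    rw [e]
    exact (hasFDerivAt_const a x).congr_fderiv (by simp [polyFun])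
  | add p q hp hq =>
    have e : polyFun (p + q) = polyFun p + polyFun q := by
      ext y; simp [polyFun]
    rw [e]
    exact (hp.add hq).congr_fderiv (by
      simp only [polyFun, map_add, add_smul, Finset.sum_add_distrib])
  | mul_X p i hp =>
    have h1 : HasFDerivAt (fun x : Eucl n => x i) (EuclideanSpace.proj i : Eucl n →L[ℝ] ℝ) x :=
      (EuclideanSpace.proj i : Eucl n →L[ℝ] ℝ).hasFDerivAt
    have := hp.mul h1
    have e : polyFun (p * X i) = polyFun p * fun x : Eucl n => x i := by
      ext y; simp [polyFun]
    rw [e]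
    refine this.congr_fderiv ?_
    simp only [polyFun, pderiv_mul, map_add, map_mul, eval_X, add_smul, Finset.sum_add_distrib,
      pderiv_X, Finset.smul_sum, smul_smul]
    rw [add_comm]
    congr 1
    · exact Finset.sum_congr rfl fun j _ => by rw [mul_comm]
    · rw [Finset.sum_eq_single i]
      · simp
      · intro j _ hj
        simp [hj.symm]
      · simp

theorem fderiv_polyFun (Q : MvPolynomial (Fin n) ℝ) (x v : Eucl n) :
    fderiv ℝ (polyFun Q) x v = ∑ i, polyFun (pderiv i Q) x * v i := by
  rw [(hasFDerivAt_polyFun Q x).fderiv]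
  simp

theorem fderiv_polyFun_self (Q : MvPolynomial (Fin n) ℝ) (x : Eucl n) :
    fderiv ℝ (polyFun Q) x x = polyFun (polyEuler (Fin n) Q) x := by
  rw [fderiv_polyFun, polyEuler_apply]
  simp [polyFun, map_sum, mul_comm]

theorem contDiff_polyField (P : Fin n → MvPolynomial (Fin n) ℝ) : ContDiff ℝ ∞ (polyField P) :=
  contDiff_euclidean.2 fun i => contDiff_polyFun (P i)

theorem fderiv_apply_coord {X : Eucl n → Eucl n} {x : Eucl n} (hX : DifferentiableAt ℝ X x)
    (v : Eucl n) (i : Fin n) : (fderiv ℝ X x v) i = fderiv ℝ (fun y => X y i) x v := by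
  have := ((EuclideanSpace.proj i : Eucl n →L[ℝ] ℝ).hasFDerivAt.comp x hX.hasFDerivAt).fderiv
  have h2 : (fun y => X y i) = (EuclideanSpace.proj i : Eucl n →L[ℝ] ℝ) ∘ X := rfl
  rw [h2, this]
  rfl

theorem inner_gradient_eq_fderiv {f : Eucl n → ℝ} (x v : Eucl n) :
    ⟪gradient f x, v⟫ = fderiv ℝ f x v := by
  simp [gradient]

theorem gradient_apply_coord {f : Eucl n → ℝ} (x : Eucl n) (i : Fin n) :
    gradient f x i = fderiv ℝ f x (EuclideanSpace.single i 1) := by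
  rw [← inner_gradient_eq_fderiv, EuclideanSpace.inner_single_right]
  simp

variable {d : ℕ}

theorem inner_sphGrad_self {f : Eucl (d + 1) → ℝ} {x : Eucl (d + 1)} (hx : ‖x‖ = 1) :
    ⟪sphGrad f x, x⟫ = 0 := by
  rw [sphGrad, inner_sub_left, real_inner_smul_left, real_inner_self_eq_norm_sq, hx]
  ring

/-- The normal component ⟪∇Q, x⟫ is the Euler operator applied to Q, so the spherical gradient is
again a polynomial field and the Laplace–Beltrami operator can be computed algebraically. -/
theorem sphGrad_polyFun (Q : MvPolynomial (Fin (d + 1)) ℝ) :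
    sphGrad (polyFun Q)
      = polyField fun i => pderiv i Q - polyEuler (Fin (d + 1)) Q * X i := by
  ext x i
  rw [sphGrad, inner_gradient_eq_fderiv, fderiv_polyFun_self, PiLp.sub_apply, PiLp.smul_apply,
    gradient_apply_coord, fderiv_polyFun]
  simp [polyField, polyFun]

theorem sphDiv_polyField (P : Fin (d + 1) → MvPolynomial (Fin (d + 1)) ℝ) (x : Eucl (d + 1)) :
    sphDiv (polyField P) x
      = polyFun (∑ i, pderiv i (P i) - ∑ i, X i * polyEuler (Fin (d + 1)) (P i)) x := by
  have hd : DifferentiableAt ℝ (polyField P) x :=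
    ((contDiff_polyField P).differentiable (by simp)) x
  have hc : ∀ i, (fun y => polyField P y i) = polyFun (P i) := fun i => rfl
  unfold sphDiv
  rw [PiLp.inner_apply]
  simp only [fderiv_apply_coord hd, hc, fderiv_polyFun_self]
  simp only [polyFun, map_sub, map_sum, map_mul, eval_X]
  congr 1
  refine Finset.sum_congr rfl fun i _ => ?_
  change fderiv ℝ (polyFun (P i)) x _ = _
  rw [fderiv_polyFun]
  simp [polyFun]

theorem sum_mul_self_of_norm_eq_one {x : Eucl n} (hx : ‖x‖ = 1) : ∑ i, x i * x i = 1 := by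
  have := real_inner_self_eq_norm_sq x
  rw [hx, PiLp.inner_apply] at this
  simpa [pow_two] using this

/-- With E the Euler operator, this is -Δ_S = E² + (d-1)E - Δ, the polar form of the Laplacian at
radius 1. The sphere enters only through ∑ x_i² = 1. -/
theorem sphDiv_sphGrad_polyFun (Q : MvPolynomial (Fin (d + 1)) ℝ) {x : Eucl (d + 1)}
    (hx : ‖x‖ = 1) :
    sphDiv (sphGrad (polyFun Q)) x
      = -polyFun (polyEuler (Fin (d + 1)) (polyEuler (Fin (d + 1)) Q)
      + (d - 1 : ℝ) • polyEuler (Fin (d + 1)) Q - polyLap (Fin (d + 1)) Q) x := by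
  rw [sphGrad_polyFun, sphDiv_polyField]
  set E := polyEuler (Fin (d + 1)) with hE
  have h1 : ∑ i, pderiv i (pderiv i Q - E Q * X i)
      = polyLap (Fin (d + 1)) Q - E (E Q) - ((d : MvPolynomial (Fin (d + 1)) ℝ) + 1) * E Q := by
    simp only [map_sub, pderiv_mul, pderiv_X_self, Finset.sum_sub_distrib,
      Finset.sum_add_distrib, mul_one, Finset.sum_const, Finset.card_univ, Fintype.card_fin]
    rw [polyLap_apply, hE, polyEuler_apply (polyEuler (Fin (d + 1)) Q), nsmul_eq_mul]
    simp only [mul_comm (pderiv _ _) (X _)]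
    push_cast
    ring
  have h2 : ∑ i, X i * E (pderiv i Q - E Q * X i)
      = E (E Q) - E Q - (∑ i, X i * X i) * (E (E Q) + E Q) := by
    have a : E (E Q) = ∑ i, X i * E (pderiv i Q) + E Q := by
      conv_lhs => rw [hE, polyEuler_apply Q, ← hE, map_sum]
      rw [show E Q = ∑ i, X i * pderiv i Q from polyEuler_apply Q, ← Finset.sum_add_distrib]
      refine Finset.sum_congr rfl fun i _ => ?_
      rw [hE, polyEuler_mul, polyEuler_X]
      ring
    have b : ∀ i, X i * E (pderiv i Q - E Q * X i)
        = X i * E (pderiv i Q) - (X i * X i) * (E (E Q) + E Q) := fun i => by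
      rw [map_sub, hE, polyEuler_mul, polyEuler_X]
      ring
    rw [Finset.sum_congr rfl fun i _ => b i, Finset.sum_sub_distrib, ← Finset.sum_mul]
    linear_combination -a
  rw [h1, h2]
  simp only [polyFun, map_sub, map_add, map_mul, map_sum, eval_X, map_one, map_natCast, smul_eval,
    sum_mul_self_of_norm_eq_one hx]
  ring

/-- Restrictions of lifted eigenpolynomials are eigenfunctions of the spherical Laplacian. -/
theorem sphDiv_sphGrad_eigenPoly {s k : ℕ} (hd : 1 ≤ d) (hs : s ≤ 1)
    {p : MvPolynomial (Fin d) ℝ} (hp : p.IsHomogeneous k) {x : Eucl (d + 1)} (hx : ‖x‖ = 1) :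
    sphDiv (sphGrad (polyFun (hemiLift d s (eigenPoly d s k p)))) x
      = -(hemiEigenvalue d s k * polyFun (hemiLift d s (eigenPoly d s k p)) x) := by
  rw [sphDiv_sphGrad_polyFun _ hx, sphereOperator_hemiLift hs, reducedLap_eigenPoly hd hp,
    map_smul]
  simp [polyFun]

theorem sphDiv_smul {f : Eucl (d + 1) → ℝ} {X : Eucl (d + 1) → Eucl (d + 1)} {x : Eucl (d + 1)}
    (hf : DifferentiableAt ℝ f x) (hX : DifferentiableAt ℝ X x) :
    sphDiv (fun y => f y • X y) x = f x * sphDiv X x + ⟪sphGrad f x, X x⟫ := by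
  unfold sphDiv sphGrad
  rw [(hf.hasFDerivAt.fun_smul hX.hasFDerivAt).fderiv, inner_gradient_eq_fderiv, inner_sub_left,
    real_inner_smul_left, PiLp.inner_apply (gradient f x)]
  simp only [add_apply, smul_apply,
    ContinuousLinearMap.smulRight_apply, PiLp.add_apply, PiLp.smul_apply, smul_eq_mul,
    Finset.sum_add_distrib, inner_add_left, real_inner_smul_left, ← Finset.mul_sum,
    gradient_apply_coord]
  rw [real_inner_comm x (X x)]
  simp only [RCLike.inner_apply, conj_trivial, mul_comm (X x _)]
  ring

theorem sphGrad_mul {f g : Eucl (d + 1) → ℝ} {x : Eucl (d + 1)}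
    (hf : DifferentiableAt ℝ f x) (hg : DifferentiableAt ℝ g x) :
    sphGrad (fun y => f y * g y) x = f x • sphGrad g x + g x • sphGrad f x := by
  have h : gradient (fun y => f y * g y) x = f x • gradient g x + g x • gradient f x := by
    unfold gradient
    rw [fderiv_fun_mul hf hg, map_add]
    simp
  unfold sphGrad
  rw [h, inner_add_left, real_inner_smul_left, real_inner_smul_left]
  module

end Calculus

end HemisphereWeyl
end

/-! ### The divergence theorem on the sphere, by radial extension. -/

noncomputable section

namespace HemisphereWeyl

open MeasureTheory

section Radial

variable {E : Type*} [NormedAddCommGroup E] [InnerProductSpace ℝ E]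

theorem hasFDerivAt_norm_of_ne_zero {x : E} (hx : x ≠ 0) :
    HasFDerivAt (fun y : E => ‖y‖) (‖x‖⁻¹ • innerSL ℝ x) x := by
  have h1 : DifferentiableAt ℝ (fun y : E => ‖y‖) x := differentiableAt_id.norm ℝ hx
  have h2 := (h1.hasFDerivAt.pow 2).unique (hasStrictFDerivAt_norm_sq x).hasFDerivAt
  refine h1.hasFDerivAt.congr_fderiv ?_
  have hx' : ‖x‖ ≠ 0 := norm_ne_zero_iff.2 hx
  ext v
  have h3 := congrArg (fun L => L v) h2
  simp at h3 ⊢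
  field_simp
  linarith

variable {F : Type*} [NormedAddCommGroup F] [NormedSpace ℝ F]

/-- A radial bump, concentrated near the unit sphere. -/
def radialBump : ContDiffBump (1 : ℝ) := ⟨1 / 4, 1 / 2, by norm_num, by norm_num⟩

omit [InnerProductSpace ℝ E] in
theorem radialBump_norm_eventuallyEq_zero :
    (fun x : E => radialBump ‖x‖) =ᶠ[nhds 0] fun _ => 0 := by
  filter_upwards [Metric.ball_mem_nhds (0 : E) (show (0 : ℝ) < 1 / 2 by norm_num)] with x hx
  refine radialBump.zero_of_le_dist ?_
  rw [mem_ball_zero_iff] at hx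
  rw [Real.dist_eq, abs_of_nonpos (by linarith)]
  change 1 / 2 ≤ _
  linarith

/-- The bump vanishes near the origin, the only singular point of functions of x/|x|. -/
theorem contDiff_radialBump_smul {g : E → F} (hg : ∀ x ≠ 0, ContDiffAt ℝ ∞ g x) :
    ContDiff ℝ ∞ fun x => radialBump ‖x‖ • g x := by
  refine contDiff_iff_contDiffAt.2 fun x => ?_
  by_cases hx : x = 0
  · subst hx
    refine contDiffAt_const (c := (0 : F)) |>.congr_of_eventuallyEq ?_
    filter_upwards [radialBump_norm_eventuallyEq_zero] with y hy
    rw [hy, zero_smul]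
  · exact (radialBump.contDiffAt.comp x (contDiffAt_norm ℝ hx)).smul (hg x hx)

omit [InnerProductSpace ℝ E] in
theorem hasCompactSupport_radialBump_smul [ProperSpace E] (g : E → F) :
    HasCompactSupport fun x => radialBump ‖x‖ • g x := by
  refine HasCompactSupport.intro (isCompact_closedBall (0 : E) 2) fun x hx => ?_
  rw [mem_closedBall_zero_iff, not_le] at hx
  rw [radialBump.zero_of_le_dist, zero_smul]
  rw [Real.dist_eq, abs_of_nonneg (by linarith)]
  change 1 / 2 ≤ _
  linarith

theorem contDiffAt_normalize {x : E} (hx : x ≠ 0) : ContDiffAt ℝ ∞ (fun y : E => ‖y‖⁻¹ • y) x :=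
  ((contDiffAt_norm ℝ hx).inv (norm_ne_zero_iff.2 hx)).smul contDiffAt_id

end Radial

theorem integral_polar {E : Type*} [NormedAddCommGroup E] [NormedSpace ℝ E] [Nontrivial E]
    [MeasurableSpace E] [BorelSpace E] [FiniteDimensional ℝ E] (μ : Measure E) [μ.IsAddHaarMeasure]
    (h : ℝ → ℝ) (G : E → ℝ) :
    ∫ x, h ‖x‖ * G (‖x‖⁻¹ • x) ∂μ = (∫ u, G u.1 ∂μ.toSphere)
      * ∫ r, h r.1 ∂Measure.volumeIoiPow (Module.finrank ℝ E - 1) := by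
  calc ∫ x, h ‖x‖ * G (‖x‖⁻¹ • x) ∂μ
      = ∫ x : ({(0)}ᶜ : Set E), h ‖x.1‖ * G (‖x.1‖⁻¹ • x.1) ∂(μ.comap (↑)) := by
        rw [integral_subtype_comap (measurableSet_singleton _).compl
          fun x => h ‖x‖ * G (‖x‖⁻¹ • x), restrict_compl_singleton]
    _ = ∫ x, G x.1.1 * h x.2.1
          ∂μ.toSphere.prod (.volumeIoiPow (Module.finrank ℝ E - 1)) := by
        rw [← μ.measurePreserving_homeomorphUnitSphereProd.integral_comp
          (Homeomorph.measurableEmbedding _)]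
        simp [mul_comm]
    _ = _ := integral_prod_mul (fun u : Metric.sphere (0 : E) 1 => G u.1)
          fun r : Set.Ioi (0 : ℝ) => h r.1

theorem integral_fderiv_eq_zero {n : ℕ} {f : Eucl n → ℝ} (hf : ContDiff ℝ ∞ f)
    (hc : HasCompactSupport f) (v : Eucl n) : ∫ x, fderiv ℝ f x v = 0 := by
  have hcont : Continuous fun x => fderiv ℝ f x v :=
    (hf.continuous_fderiv (by simp)).clm_apply continuous_const
  have hi : Integrable fun x => fderiv ℝ f x v :=
    hcont.integrable_of_hasCompactSupport (hc.fderiv_apply (𝕜 := ℝ) v)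
  have := integral_mul_fderiv_eq_neg_fderiv_mul_of_integrable (μ := volume)
    (f := fun _ : Eucl n => (1 : ℝ)) (g := f) (v := v) (by simp) (by simpa using hi)
    (by simpa using hf.continuous.integrable_of_hasCompactSupport hc) (by simp)
    (fun x _ => hf.differentiable (by simp) x)
  simpa using this

variable {d : ℕ}

/-- The Euclidean divergence of a radially cut off extension of a tangent field. -/
theorem div_radialBump_smul_normalize {X : Eucl (d + 1) → Eucl (d + 1)} (hX : ContDiff ℝ ∞ X)
    (ht : ∀ x : Sph d, ⟪X x, (x : Eucl (d + 1))⟫ = 0) {x : Eucl (d + 1)} (hx : x ≠ 0) :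
    ∑ i, (fderiv ℝ (fun y => radialBump ‖y‖ • X (‖y‖⁻¹ • y)) x (EuclideanSpace.single i 1)) i
      = (radialBump ‖x‖ * ‖x‖⁻¹) * sphDiv X (‖x‖⁻¹ • x) := by
  have hr : ‖x‖ ≠ 0 := norm_ne_zero_iff.2 hx
  have hN := hasFDerivAt_norm_of_ne_zero hx
  have hρ := ((radialBump.contDiff (n := 1)).differentiable (by simp) ‖x‖).hasDerivAt
  have h1 := hρ.comp_hasFDerivAt x hN
  have hinv := (hasDerivAt_inv hr).comp_hasFDerivAt x hN
  have h2 := hinv.fun_smul (hasFDerivAt_id x)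
  have hXd : HasFDerivAt X (fderiv ℝ X (‖x‖⁻¹ • x)) (‖x‖⁻¹ • x) :=
    (hX.differentiable (by simp) _).hasFDerivAt
  have h3 := HasFDerivAt.comp (f := fun y : Eucl (d + 1) => ‖y‖⁻¹ • y) x hXd h2
  have h4 := h1.fun_smul h3
  have h5 : fderiv ℝ (fun y => radialBump ‖y‖ • X (‖y‖⁻¹ • y)) x = _ := h4.fderiv
  set u := ‖x‖⁻¹ • x with hu
  have hxu : x = ‖x‖ • u := by rw [hu, smul_smul, mul_inv_cancel₀ hr, one_smul]
  have hu1 : ‖u‖ = 1 := by rw [hu, norm_smul, norm_inv, norm_norm, inv_mul_cancel₀ hr]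
  have htu : ⟪X u, u⟫ = 0 := ht ⟨u, by simpa using hu1⟩
  set L := fderiv ℝ X u with hL
  have h6 : ∀ i, (fderiv ℝ (fun y => radialBump ‖y‖ • X (‖y‖⁻¹ • y)) x
      (EuclideanSpace.single i 1)) i = deriv radialBump ‖x‖ * (u i * X u i)
      + (radialBump ‖x‖ * ‖x‖⁻¹) * ((L (EuclideanSpace.single i 1)) i - u i * (L u) i) := by
    intro i
    rw [h5]
    have e1 : ⟪x, EuclideanSpace.single i (1 : ℝ)⟫ = ‖x‖ * u i := by
      rw [EuclideanSpace.inner_single_right]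
      nth_rewrite 1 [hxu]
      simp
    have e2 : L x = ‖x‖ • L u := by
      nth_rewrite 1 [hxu]
      rw [map_smul]
    simp [e1, e2]
    rw [← hu]
    field_simp
    ring
  rw [Finset.sum_congr rfl fun i _ => h6 i, Finset.sum_add_distrib, ← Finset.mul_sum,
    ← Finset.mul_sum, Finset.sum_sub_distrib]
  -- The derivative of the bump multiplies the radial component of X, which is zero by tangency.
  have e3 : ∑ i, u i * X u i = 0 := by
    rw [← htu, PiLp.inner_apply]
    simp
  have e4 : ⟪L u, u⟫ = ∑ i, u i * (L u) i := by
    rw [PiLp.inner_apply]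
    simp
  rw [e3, mul_zero, zero_add, sphDiv, e4]

/-- The divergence theorem on the unit sphere. -/
theorem integral_sphere_sphDiv {X : Eucl (d + 1) → Eucl (d + 1)} (hX : ContDiff ℝ ∞ X)
    (ht : ∀ x : Sph d, ⟪X x, (x : Eucl (d + 1))⟫ = 0) :
    ∫ x : Sph d, sphDiv X x ∂(volume : Measure (Eucl (d + 1))).toSphere = 0 := by
  have hZs : ContDiff ℝ ∞ fun y => radialBump ‖y‖ • X (‖y‖⁻¹ • y) :=
    contDiff_radialBump_smul fun x hx => hX.contDiffAt.comp x (contDiffAt_normalize hx)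
  have hZc := hasCompactSupport_radialBump_smul fun y => X (‖y‖⁻¹ • y)
  set Z := fun y => radialBump ‖y‖ • X (‖y‖⁻¹ • y) with hZ
  -- The extended field has compact support in ℝ^{d+1}, so its Euclidean divergence has integral
  -- zero; in polar coordinates this integral is the spherical one times a radial factor.
  have hzero : ∫ x, ∑ i, (fderiv ℝ Z x (EuclideanSpace.single i 1)) i = 0 := by
    have hi : ∀ i, ContDiff ℝ ∞ fun y => Z y i := fun i => contDiff_euclidean.1 hZs i
    have hic : ∀ i, HasCompactSupport fun y => Z y i := fun i =>
      hZc.comp_left (g := fun v : Eucl (d + 1) => v i) rfl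
    simp only [fderiv_apply_coord (hZs.differentiable (by simp) _)]
    rw [integral_finsetSum]
    · exact Finset.sum_eq_zero fun i _ => integral_fderiv_eq_zero (hi i) (hic i) _
    · intro i _
      exact (((hi i).continuous_fderiv (by simp)).clm_apply
        continuous_const).integrable_of_hasCompactSupport ((hic i).fderiv_apply (𝕜 := ℝ) _)
  have hae : ∀ᵐ x : Eucl (d + 1), x ≠ 0 := by
    simp [ae_iff]
  have h1 : ∫ x, ∑ i, (fderiv ℝ Z x (EuclideanSpace.single i 1)) i
      = ∫ x : Eucl (d + 1), (fun r => radialBump r * r⁻¹) ‖x‖ * sphDiv X (‖x‖⁻¹ • x) :=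
    integral_congr_ae (hae.mono fun x hx => div_radialBump_smul_normalize hX ht hx)
  rw [h1, integral_polar volume (fun r => radialBump r * r⁻¹) (sphDiv X), mul_eq_zero] at hzero
  -- The radial factor is nonzero: with angular part 1 the polar formula would otherwise give zero
  -- for the integral of a nonnegative function that is positive on the unit sphere.
  refine hzero.resolve_right fun h0 => ?_
  have h2 := integral_polar (volume : Measure (Eucl (d + 1))) (fun r => radialBump r * r⁻¹)
    fun _ => 1
  rw [h0, mul_zero] at h2
  have hcont : Continuous fun x : Eucl (d + 1) => radialBump ‖x‖ • ‖x‖⁻¹ :=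
    (contDiff_radialBump_smul fun x hx =>
      (contDiffAt_norm ℝ hx).inv (norm_ne_zero_iff.2 hx)).continuous
  have h3 := hcont.integral_pos_of_hasCompactSupport_nonneg_nonzero (μ := volume)
    (hasCompactSupport_radialBump_smul _)
    (fun x => mul_nonneg radialBump.nonneg (inv_nonneg.2 (norm_nonneg x)))
    (x := EuclideanSpace.single 0 1) (by
      have : radialBump 1 = 1 :=
        radialBump.one_of_mem_closedBall (Metric.mem_closedBall_self radialBump.rIn_pos.le)
      simp [this])
  simp only [mul_one] at h2
  exact h3.ne' h2

theorem sphDiv_eq_zero_of_notMem_tsupport {X : Eucl (d + 1) → Eucl (d + 1)} {x : Eucl (d + 1)}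
    (hx : x ∉ tsupport X) : sphDiv X x = 0 := by
  have h : X =ᶠ[nhds x] fun _ => 0 := notMem_tsupport_iff_eventuallyEq.1 hx
  unfold sphDiv
  rw [h.fderiv_eq]
  simp

/-- The divergence theorem for compactly supported fields on the open hemisphere. -/
theorem integral_sphDiv_eq_zero {X : Eucl (d + 1) → Eucl (d + 1)} (hX : IsTestField X) :
    ∫ x, sphDiv X x ∂(hemiMeasure d) = 0 := by
  rw [hemiMeasure, setIntegral_eq_integral_of_forall_compl_eq_zero,
    integral_sphere_sphDiv hX.1.1 hX.2]
  exact fun x hx => sphDiv_eq_zero_of_notMem_tsupport fun h => hx (hX.1.2.2 h)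

end HemisphereWeyl
end

/-! ### Cutoffs near the equator and limits in L². -/

noncomputable section

namespace HemisphereWeyl

open MeasureTheory Filter Topology

section Cutoff

/-- A smooth step: `0` on `(-∞, 1]`, `1` on `[2, ∞)`. -/
def smoothStep (t : ℝ) : ℝ := Real.smoothTransition (t - 1)

theorem contDiff_smoothStep : ContDiff ℝ ∞ smoothStep :=
  Real.smoothTransition.contDiff.comp (contDiff_id.sub contDiff_const)

theorem deriv_smoothStep_of_two_lt {t : ℝ} (ht : 2 < t) : deriv smoothStep t = 0 := by
  have h : smoothStep =ᶠ[𝓝 t] fun _ => 1 := by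
    filter_upwards [lt_mem_nhds ht] with s hs
    exact Real.smoothTransition.one_of_one_le (by linarith)
  rw [h.deriv_eq, deriv_const]

theorem deriv_smoothStep_of_lt_one {t : ℝ} (ht : t < 1) : deriv smoothStep t = 0 := by
  have h : smoothStep =ᶠ[𝓝 t] fun _ => 0 := by
    filter_upwards [gt_mem_nhds ht] with s hs
    exact Real.smoothTransition.zero_of_nonpos (by linarith)
  rw [h.deriv_eq, deriv_const]

theorem continuous_deriv_smoothStep : Continuous (deriv smoothStep) :=
  contDiff_smoothStep.continuous_deriv (by simp)

/-- Gives a bound on `cutoffSlope` independent of n: a factor x_{d+1} exactly offsets the growth n+1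
of the gradient of the cutoff. -/
theorem exists_bound_mul_deriv_smoothStep : ∃ C, ∀ t, |t * deriv smoothStep t| ≤ C := by
  obtain ⟨C, hC⟩ := (isCompact_Icc (a := (1 : ℝ)) (b := 2)).exists_bound_of_continuousOn
    (continuous_id.mul continuous_deriv_smoothStep).continuousOn
  have h0 : 0 ≤ C := (norm_nonneg _).trans (hC 1 (by norm_num))
  refine ⟨C, fun t => ?_⟩
  rcases lt_or_ge t 1 with h | h
  · simpa [deriv_smoothStep_of_lt_one h] using h0
  · rcases lt_or_ge 2 t with h' | h'
    · simpa [deriv_smoothStep_of_two_lt h'] using h0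
    · exact hC t ⟨h, h'⟩

variable {d : ℕ}

/-- A bump equal to `1` near the unit sphere. -/
def ballBump (d : ℕ) : ContDiffBump (0 : Eucl (d + 1)) := ⟨2, 3, by norm_num, by norm_num⟩

/-- Cutoffs that exhaust the open hemisphere. -/
def cutoff (d n : ℕ) (x : Eucl (d + 1)) : ℝ :=
  smoothStep ((n + 1) * x (Fin.last d)) * ballBump d x

/-- The normal derivative of the cutoff, multiplied by the distance to the equatorial plane. -/
def cutoffSlope (d n : ℕ) (x : Eucl (d + 1)) : ℝ :=
  ((n + 1) * x (Fin.last d)) * deriv smoothStep ((n + 1) * x (Fin.last d))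

theorem contDiff_coord (i : Fin (d + 1)) : ContDiff ℝ ∞ fun x : Eucl (d + 1) => x i := by
  fun_prop

theorem contDiff_cutoff (n : ℕ) : ContDiff ℝ ∞ (cutoff d n) :=
  (contDiff_smoothStep.comp (contDiff_const.mul (contDiff_coord _))).mul (ballBump d).contDiff

theorem continuous_cutoffSlope (n : ℕ) : Continuous (cutoffSlope d n) := by
  have h : Continuous fun x : Eucl (d + 1) => ((n : ℝ) + 1) * x (Fin.last d) := by fun_prop
  exact h.mul (continuous_deriv_smoothStep.comp h)

theorem isTest_cutoff_smul {F : Type*} [NormedAddCommGroup F] [NormedSpace ℝ F] (n : ℕ)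
    {f : Eucl (d + 1) → F} (hf : ContDiff ℝ ∞ f) : IsTest fun x => cutoff d n x • f x := by
  refine ⟨(contDiff_cutoff n).smul hf, ?_, ?_⟩
  · have h : HasCompactSupport (cutoff d n) := (ballBump d).hasCompactSupport.mul_left
    exact h.smul_right
  · have hsub : tsupport (fun x => cutoff d n x • f x)
        ⊆ {x | 1 ≤ ((n : ℝ) + 1) * x (Fin.last d)} := by
      refine closure_minimal (fun x hx => ?_) (isClosed_le continuous_const (by fun_prop))
      by_contra h
      refine hx ?_
      have : smoothStep (((n : ℝ) + 1) * x (Fin.last d)) = 0 :=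
        Real.smoothTransition.zero_of_nonpos (by simp at h; linarith)
      simp [cutoff, this]
    refine hsub.trans fun x hx => ?_
    have h1 : (0 : ℝ) < n + 1 := by positivity
    exact pos_of_mul_pos_right (lt_of_lt_of_le one_pos hx) h1.le

theorem abs_cutoff_le_one (n : ℕ) (x : Eucl (d + 1)) : |cutoff d n x| ≤ 1 := by
  unfold cutoff
  rw [abs_mul, smoothStep, abs_of_nonneg (Real.smoothTransition.nonneg _), abs_of_nonneg (ballBump d).nonneg]
  exact mul_le_one₀ (Real.smoothTransition.le_one _) (ballBump d).nonneg (ballBump d).le_one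

theorem eventually_two_lt_mul {h : ℝ} (hh : 0 < h) : ∀ᶠ n : ℕ in atTop, 2 < ((n : ℝ) + 1) * h :=
  ((tendsto_atTop_add_const_right _ 1 tendsto_natCast_atTop_atTop).atTop_mul_const
    hh).eventually_gt_atTop 2

theorem tendsto_cutoff {x : Sph d} (hx : x ∈ hemisphere d) :
    Tendsto (fun n => cutoff d n x) atTop (𝓝 1) := by
  refine tendsto_const_nhds.congr' ?_
  filter_upwards [eventually_two_lt_mul hx] with n hn
  have h1 : ballBump d (x : Eucl (d + 1)) = 1 := (ballBump d).one_of_mem_closedBall (by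
    have := x.2
    rw [mem_sphere_zero_iff_norm] at this
    rw [mem_closedBall_zero_iff, this]
    exact one_le_two)
  rw [cutoff, h1, smoothStep, Real.smoothTransition.one_of_one_le (by linarith), one_mul]

theorem tendsto_cutoffSlope {x : Sph d} (hx : x ∈ hemisphere d) :
    Tendsto (fun n => cutoffSlope d n x) atTop (𝓝 0) := by
  refine tendsto_const_nhds.congr' ?_
  filter_upwards [eventually_two_lt_mul hx] with n hn
  rw [cutoffSlope, deriv_smoothStep_of_two_lt hn, mul_zero]

theorem fderiv_cutoff (n : ℕ) {x : Eucl (d + 1)} (hx : ‖x‖ = 1) (v : Eucl (d + 1)) :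
    fderiv ℝ (cutoff d n) x v
      = (n + 1) * deriv smoothStep ((n + 1) * x (Fin.last d)) * v (Fin.last d) := by
  have h : cutoff d n =ᶠ[𝓝 x] fun y => smoothStep ((n + 1) * y (Fin.last d)) := by
    have : x ∈ Metric.ball (0 : Eucl (d + 1)) 2 := by
      rw [mem_ball_zero_iff, hx]; exact one_lt_two
    filter_upwards [Metric.isOpen_ball.mem_nhds this] with y hy
    rw [cutoff, (ballBump d).one_of_mem_closedBall (Metric.ball_subset_closedBall hy), mul_one]
  have h1 : HasFDerivAt (fun y : Eucl (d + 1) => ((n : ℝ) + 1) * y (Fin.last d))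
      (((n : ℝ) + 1) • (EuclideanSpace.proj (Fin.last d) : Eucl (d + 1) →L[ℝ] ℝ)) x :=
    (EuclideanSpace.proj (Fin.last d) : Eucl (d + 1) →L[ℝ] ℝ).hasFDerivAt.const_mul _
  have h2 := ((contDiff_smoothStep.differentiable (by simp)
    (((n : ℝ) + 1) * x (Fin.last d))).hasDerivAt).comp_hasFDerivAt x h1
  have h3 : fderiv ℝ (fun y : Eucl (d + 1) => smoothStep (((n : ℝ) + 1) * y (Fin.last d))) x = _ :=
    h2.fderiv
  rw [h.fderiv_eq, h3]
  simp
  ring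

/-- Near the unit sphere the ball bump is identically 1, so only the step in x_{d+1} contributes,
along the tangential part of e_{d+1}. -/
theorem sphGrad_cutoff (n : ℕ) {x : Eucl (d + 1)} (hx : ‖x‖ = 1) :
    sphGrad (cutoff d n) x = ((n + 1) * deriv smoothStep ((n + 1) * x (Fin.last d)))
      • (EuclideanSpace.single (Fin.last d) 1 - x (Fin.last d) • x) := by
  classical
  ext i
  rw [sphGrad, PiLp.sub_apply, PiLp.smul_apply, gradient_apply_coord, inner_gradient_eq_fderiv,
    fderiv_cutoff n hx, fderiv_cutoff n hx]
  simp [mul_sub, eq_comm, mul_assoc]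

end Cutoff

section Measure

variable {d : ℕ} {F : Type*} [NormedAddCommGroup F]

theorem norm_coe_sph (x : Sph d) : ‖(x : Eucl (d + 1))‖ = 1 := mem_sphere_zero_iff_norm.1 x.2

theorem isOpen_hemisphere : IsOpen (hemisphere d) :=
  isOpen_lt continuous_const
    ((contDiff_coord (Fin.last d)).continuous.comp continuous_subtype_val)

theorem ae_mem_hemisphere : ∀ᵐ x ∂(hemiMeasure d), x ∈ hemisphere d :=
  ae_restrict_mem isOpen_hemisphere.measurableSet

theorem exists_bound_sph {f : Eucl (d + 1) → F} (hf : Continuous f) :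
    ∃ C, ∀ x : Sph d, ‖f x‖ ≤ C := by
  obtain ⟨C, hC⟩ := (isCompact_univ (X := Sph d)).exists_bound_of_continuousOn
    (hf.comp continuous_subtype_val).continuousOn
  exact ⟨C, fun x => hC x trivial⟩

theorem aestronglyMeasurable_sph [SecondCountableTopology F] {f : Eucl (d + 1) → F}
    (hf : Continuous f) :
    AEStronglyMeasurable (fun x : Sph d => f x) (hemiMeasure d) :=
  (hf.comp continuous_subtype_val).aestronglyMeasurable

theorem memLp_sph [SecondCountableTopology F] {f : Eucl (d + 1) → F} (hf : Continuous f) :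
    MemLp (fun x : Sph d => f x) 2 (hemiMeasure d) := by
  obtain ⟨C, hC⟩ := exists_bound_sph hf
  exact MemLp.of_bound (aestronglyMeasurable_sph hf) C (Eventually.of_forall hC)

theorem tendsto_integral_smul [NormedSpace ℝ F] {α : Type*} [MeasurableSpace α] {μ : Measure α}
    {u : α → F} (hu : Integrable u μ) {c : ℕ → α → ℝ} {c₀ C : ℝ}
    (hm : ∀ n, AEStronglyMeasurable (c n) μ) (hb : ∀ n, ∀ᵐ x ∂μ, |c n x| ≤ C)
    (hc : ∀ᵐ x ∂μ, Tendsto (fun n => c n x) atTop (𝓝 c₀)) :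
    Tendsto (fun n => ∫ x, c n x • u x ∂μ) atTop (𝓝 (c₀ • ∫ x, u x ∂μ)) := by
  rw [← integral_smul]
  refine tendsto_integral_of_dominated_convergence (fun x => C * ‖u x‖)
    (fun n => (hm n).smul hu.1) (hu.norm.const_mul C) (fun n => ?_) ?_
  · filter_upwards [hb n] with x hx
    rw [norm_smul]
    exact mul_le_mul_of_nonneg_right hx (norm_nonneg _)
  · filter_upwards [hc] with x hx
    exact hx.smul_const _

theorem tendsto_toLp_of_bounded {α : Type*} [MeasurableSpace α] {μ : Measure α}
    {H : Type*} [NormedAddCommGroup H] [InnerProductSpace ℝ H]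
    [IsFiniteMeasure μ] {f : ℕ → α → H} {g : α → H} (hf : ∀ n, MemLp (f n) 2 μ)
    (hg : MemLp g 2 μ) {C : ℝ} (hb : ∀ n, ∀ᵐ x ∂μ, ‖f n x - g x‖ ≤ C)
    (hc : ∀ᵐ x ∂μ, Tendsto (fun n => f n x) atTop (𝓝 (g x))) :
    Tendsto (fun n => (hf n).toLp (f n)) atTop (𝓝 (hg.toLp g)) := by
  rw [tendsto_iff_norm_sub_tendsto_zero]
  have h1 : ∀ n, ‖(hf n).toLp (f n) - hg.toLp g‖ ^ 2 = ∫ x, ‖f n x - g x‖ ^ 2 ∂μ := fun n => by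
    rw [← real_inner_self_eq_norm_sq, L2.inner_def]
    refine integral_congr_ae ?_
    rw [← MemLp.toLp_sub]
    filter_upwards [((hf n).sub hg).coeFn_toLp] with x hx
    rw [hx, real_inner_self_eq_norm_sq]
    rfl
  have h2 : Tendsto (fun n => ∫ x, ‖f n x - g x‖ ^ 2 ∂μ) atTop (𝓝 (∫ _, (0 : ℝ) ∂μ)) := by
    refine tendsto_integral_of_dominated_convergence (fun _ => C ^ 2)
      (fun n => (((hf n).1.sub hg.1).norm).pow 2) (integrable_const _) (fun n => ?_) ?_
    · filter_upwards [hb n] with x hx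
      rw [norm_pow, norm_norm]
      exact pow_le_pow_left₀ (norm_nonneg _) hx 2
    · filter_upwards [hc] with x hx
      simpa using ((hx.sub_const (g x)).norm.pow 2)
  simp only [← h1, integral_zero] at h2
  simpa using h2.sqrt

end Measure

end HemisphereWeyl
end

/-! ### Green's formulas and membership in the form domains. -/

noncomputable section

namespace HemisphereWeyl

open MeasureTheory Filter Topology MvPolynomial

variable {d : ℕ}

theorem contDiff_sphGrad_polyFun (Q : MvPolynomial (Fin (d + 1)) ℝ) :
    ContDiff ℝ ∞ (sphGrad (polyFun Q)) := by
  rw [sphGrad_polyFun]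
  exact contDiff_polyField _

/-- The class in `L²(S^d_+)` of the restriction of a polynomial. -/
def polyL2 (d : ℕ) : MvPolynomial (Fin (d + 1)) ℝ →ₗ[ℝ] HemiL2 d where
  toFun Q := (memLp_sph (contDiff_polyFun Q).continuous).toLp _
  map_add' P Q := by
    rw [← MemLp.toLp_add]
    congr 1
    ext x
    simp [polyFun]
  map_smul' c Q := by
    rw [RingHom.id_apply, ← MemLp.toLp_const_smul]
    congr 1
    ext x
    simp [polyFun]

/-- The class in `L²(S^d_+)` of the spherical gradient of a polynomial. -/
def polyGradL2 (Q : MvPolynomial (Fin (d + 1)) ℝ) : HemiL2Vec d :=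
  (memLp_sph (contDiff_sphGrad_polyFun Q).continuous).toLp _

theorem coeFn_polyL2 (Q : MvPolynomial (Fin (d + 1)) ℝ) :
    ∀ᵐ x ∂(hemiMeasure d), polyL2 d Q x = polyFun Q x :=
  (memLp_sph (contDiff_polyFun Q).continuous).coeFn_toLp

theorem coeFn_polyGradL2 (Q : MvPolynomial (Fin (d + 1)) ℝ) :
    ∀ᵐ x ∂(hemiMeasure d), polyGradL2 Q x = sphGrad (polyFun Q) x :=
  (memLp_sph (contDiff_sphGrad_polyFun Q).continuous).coeFn_toLp

theorem inner_polyL2 (Q : MvPolynomial (Fin (d + 1)) ℝ) (u : HemiL2 d) :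
    ⟪polyL2 d Q, u⟫ = ∫ x, polyFun Q x * u x ∂(hemiMeasure d) := by
  rw [L2.inner_def]
  refine integral_congr_ae ?_
  filter_upwards [coeFn_polyL2 Q] with x hx
  rw [hx]
  simp [mul_comm]

theorem inner_polyGradL2 (Q : MvPolynomial (Fin (d + 1)) ℝ) (G : HemiL2Vec d) :
    ⟪polyGradL2 Q, G⟫ = ∫ x, ⟪sphGrad (polyFun Q) x, G x⟫ ∂(hemiMeasure d) := by
  rw [L2.inner_def]
  refine integral_congr_ae ?_
  filter_upwards [coeFn_polyGradL2 Q] with x hx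
  rw [hx]

theorem isTestField_smul {f : Eucl (d + 1) → ℝ} {X : Eucl (d + 1) → Eucl (d + 1)}
    (hX : IsTestField X) (hf : ContDiff ℝ ∞ f) : IsTestField fun x => f x • X x :=
  ⟨⟨hf.smul hX.1.1, hX.1.2.1.smul_left (f := f),
    (tsupport_smul_subset_right f X).trans hX.1.2.2⟩,
    fun x => by rw [real_inner_smul_left, hX.2 x, mul_zero]⟩

theorem integrable_sph {f : Eucl (d + 1) → ℝ} (hf : Continuous f) :
    Integrable (fun x : Sph d => f x) (hemiMeasure d) :=
  (memLp_sph hf).integrable one_le_two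

theorem continuous_inner_sphGrad_polyFun (Q : MvPolynomial (Fin (d + 1)) ℝ)
    {X : Eucl (d + 1) → Eucl (d + 1)} (hX : Continuous X) :
    Continuous fun x => ⟪sphGrad (polyFun Q) x, X x⟫ :=
  (contDiff_sphGrad_polyFun Q).continuous.inner hX

/-- Polynomials have weak gradients. -/
theorem isWeakGrad_polyL2 (Q : MvPolynomial (Fin (d + 1)) ℝ) :
    IsWeakGrad (polyL2 d Q) (polyGradL2 Q) := by
  refine ⟨?_, fun X hX => ?_⟩
  · filter_upwards [coeFn_polyGradL2 Q] with x hx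
    rw [hx, inner_sphGrad_self (norm_coe_sph x)]
  · have h1 := integral_sphDiv_eq_zero (isTestField_smul hX (contDiff_polyFun Q))
    have h2 : ∀ x, sphDiv (fun x => polyFun Q x • X x) x
        = polyFun Q x * sphDiv X x + ⟪sphGrad (polyFun Q) x, X x⟫ := fun x =>
      sphDiv_smul ((contDiff_polyFun Q).differentiable (by simp) x)
        (hX.1.1.differentiable (by simp) x)
    have hc1 : Continuous fun x => polyFun Q x * sphDiv X x :=
      (contDiff_polyFun Q).continuous.mul (continuous_sphDiv hX.1.1)
    simp only [h2] at h1
    rw [integral_add (integrable_sph hc1)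
      (integrable_sph (continuous_inner_sphGrad_polyFun Q hX.1.1.continuous))] at h1
    have h3 : ∫ x, polyL2 d Q x * sphDiv X x ∂(hemiMeasure d)
        = ∫ x : Sph d, polyFun Q x * sphDiv X x ∂(hemiMeasure d) := by
      refine integral_congr_ae ?_
      filter_upwards [coeFn_polyL2 Q] with x hx
      rw [hx]
    have h4 : ∫ x, ⟪polyGradL2 Q x, X x⟫ ∂(hemiMeasure d)
        = ∫ x : Sph d, ⟪sphGrad (polyFun Q) x, X x⟫ ∂(hemiMeasure d) := by
      refine integral_congr_ae ?_
      filter_upwards [coeFn_polyGradL2 Q] with x hx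
      rw [hx]
    rw [h3, h4]
    linarith

/-- Green's formula on `H¹₀`. -/
theorem inner_polyGradL2_of_mem_sobolevH10 (Q : MvPolynomial (Fin (d + 1)) ℝ)
    {q : HemiL2 d × HemiL2Vec d} (hq : q ∈ sobolevH10 d) {c : ℝ}
    (hc : ∀ x : Sph d, sphDiv (sphGrad (polyFun Q)) x = -(c * polyFun Q x)) :
    ⟪polyGradL2 Q, q.2⟫ = c * ⟪polyL2 d Q, q.1⟫ := by
  have hcl : IsClosed {q : HemiL2 d × HemiL2Vec d | ⟪polyGradL2 Q, q.2⟫ = c * ⟪polyL2 d Q, q.1⟫} :=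
    isClosed_eq (by fun_prop) (by fun_prop)
  refine closure_minimal ?_ hcl hq
  rintro ⟨u, G⟩ ⟨f, hf, hu, hG⟩
  simp only at hu hG
  have hfield : IsTestField fun x => f x • sphGrad (polyFun Q) x :=
    ⟨⟨hf.1.smul (contDiff_sphGrad_polyFun Q), hf.2.1.smul_right,
      (tsupport_smul_subset_left f _).trans hf.2.2⟩,
      fun x => by rw [real_inner_smul_left, inner_sphGrad_self (norm_coe_sph x), mul_zero]⟩
  have h1 := integral_sphDiv_eq_zero hfield
  have hcont : Continuous fun x : Eucl (d + 1) => polyFun Q x * f x :=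
    (contDiff_polyFun Q).continuous.mul hf.1.continuous
  have hint : Integrable (fun x : Sph d => ⟪sphGrad (polyFun Q) x, sphGrad f x⟫)
      (hemiMeasure d) := by
    have h := L2.integrable_inner (𝕜 := ℝ) (polyGradL2 Q) G
    refine h.congr ?_
    filter_upwards [hG, coeFn_polyGradL2 Q] with x hx hx'
    rw [hx, hx']
  have h2 : ∀ x : Sph d, sphDiv (fun x => f x • sphGrad (polyFun Q) x) x
      = -c * (polyFun Q x * f x) + ⟪sphGrad (polyFun Q) x, sphGrad f x⟫ := fun x => by
    rw [sphDiv_smul (hf.differentiable x)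
      ((contDiff_sphGrad_polyFun Q).differentiable (by simp) _), hc, real_inner_comm]
    ring
  simp only [h2] at h1
  rw [integral_add ((integrable_sph hcont).const_mul _) hint, integral_const_mul] at h1
  change ⟪polyGradL2 Q, G⟫ = c * ⟪polyL2 d Q, u⟫
  have h3 : ∫ x, polyFun Q x * u x ∂(hemiMeasure d)
      = ∫ x : Sph d, polyFun Q x * f x ∂(hemiMeasure d) := by
    refine integral_congr_ae ?_
    filter_upwards [hu] with x hx
    rw [hx]
  have h4 : ∫ x, ⟪sphGrad (polyFun Q) x, G x⟫ ∂(hemiMeasure d)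
      = ∫ x : Sph d, ⟪sphGrad (polyFun Q) x, sphGrad f x⟫ ∂(hemiMeasure d) := by
    refine integral_congr_ae ?_
    filter_upwards [hG] with x hx
    rw [hx]
  rw [inner_polyGradL2, inner_polyL2, h3, h4]
  linarith

theorem inner_sphGrad_cutoff (n : ℕ) {x v : Eucl (d + 1)} (hx : ‖x‖ = 1) (hv : ⟪v, x⟫ = 0) :
    ⟪sphGrad (cutoff d n) x, v⟫
      = (n + 1) * deriv smoothStep ((n + 1) * x (Fin.last d)) * v (Fin.last d) := by
  rw [sphGrad_cutoff n hx, real_inner_smul_left, inner_sub_left, real_inner_smul_left,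
    real_inner_comm v x, hv, mul_zero, sub_zero, EuclideanSpace.inner_single_left]
  simp

/-- When ∂_{d+1}Q = 0, the last component of the spherical gradient of Q is -x_{d+1} times the Euler
term. This factor x_{d+1} turns the gradient of the cutoff into the bounded `cutoffSlope`. -/
theorem sphDiv_cutoff_smul_sphGrad (n : ℕ) {Q : MvPolynomial (Fin (d + 1)) ℝ}
    (hQ : pderiv (Fin.last d) Q = 0) {x : Eucl (d + 1)} (hx : ‖x‖ = 1) :
    sphDiv (fun y => cutoff d n y • sphGrad (polyFun Q) y) x
      = cutoff d n x * sphDiv (sphGrad (polyFun Q)) x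
        - cutoffSlope d n x * polyFun (polyEuler (Fin (d + 1)) Q) x := by
  rw [sphDiv_smul ((contDiff_cutoff n).differentiable (by simp) x)
    ((contDiff_sphGrad_polyFun Q).differentiable (by simp) x),
    inner_sphGrad_cutoff n hx (inner_sphGrad_self hx)]
  have h : sphGrad (polyFun Q) x (Fin.last d)
      = -(polyFun (polyEuler (Fin (d + 1)) Q) x * x (Fin.last d)) := by
    rw [sphGrad_polyFun]
    simp [polyField, polyFun, hQ]
  rw [h, cutoffSlope]
  ring

/-- Green's formula on `H¹` for polynomials with vanishing normal derivative on the equator. -/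
theorem inner_polyGradL2_of_mem_sobolevH1 {Q : MvPolynomial (Fin (d + 1)) ℝ}
    (hQ : pderiv (Fin.last d) Q = 0)
    {q : HemiL2 d × HemiL2Vec d} (hq : q ∈ sobolevH1 d) {c : ℝ}
    (hc : ∀ x : Sph d, sphDiv (sphGrad (polyFun Q)) x = -(c * polyFun Q x)) :
    ⟪polyGradL2 Q, q.2⟫ = c * ⟪polyL2 d Q, q.1⟫ := by
  obtain ⟨u, G⟩ := q
  change ⟪polyGradL2 Q, G⟫ = c * ⟪polyL2 d Q, u⟫
  have hqw : IsWeakGrad u G := hq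
  obtain ⟨C, hC⟩ := exists_bound_mul_deriv_smoothStep
  have hu : Integrable u (hemiMeasure d) := (Lp.memLp u).integrable one_le_two
  have hint : ∀ f : Eucl (d + 1) → ℝ, Continuous f →
      Integrable (fun x : Sph d => f x * u x) (hemiMeasure d) := fun f hf => by
    obtain ⟨M, hM⟩ := exists_bound_sph hf
    exact hu.bdd_mul (c := M) (aestronglyMeasurable_sph hf) (Eventually.of_forall hM)
  have hI1 := hint _ (contDiff_polyFun Q).continuous
  have hI2 := hint _ (contDiff_polyFun (polyEuler (Fin (d + 1)) Q)).continuous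
  have hI3 : Integrable (fun x : Sph d => ⟪sphGrad (polyFun Q) x, G x⟫) (hemiMeasure d) := by
    simpa only [real_inner_comm] using
      integrable_inner_field G (contDiff_sphGrad_polyFun Q).continuous
  have hcm : ∀ n, AEStronglyMeasurable (fun x : Sph d => cutoff d n x) (hemiMeasure d) :=
    fun n => aestronglyMeasurable_sph (contDiff_cutoff n).continuous
  have hsm : ∀ n, AEStronglyMeasurable (fun x : Sph d => cutoffSlope d n x) (hemiMeasure d) :=
    fun n => aestronglyMeasurable_sph (continuous_cutoffSlope n)
  have hcb : ∀ n, ∀ᵐ x : Sph d ∂(hemiMeasure d), |cutoff d n x| ≤ 1 :=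
    fun n => Eventually.of_forall fun x => abs_cutoff_le_one n (x : Eucl (d + 1))
  have hsb : ∀ n, ∀ᵐ x : Sph d ∂(hemiMeasure d), |cutoffSlope d n x| ≤ C :=
    fun n => Eventually.of_forall fun x => hC _
  have hcl : ∀ᵐ x : Sph d ∂(hemiMeasure d), Tendsto (fun n => cutoff d n x) atTop (𝓝 1) :=
    ae_mem_hemisphere.mono fun x hx => tendsto_cutoff hx
  have hsl : ∀ᵐ x : Sph d ∂(hemiMeasure d), Tendsto (fun n => cutoffSlope d n x) atTop (𝓝 0) :=
    ae_mem_hemisphere.mono fun x hx => tendsto_cutoffSlope hx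
  -- The definition of the weak gradient is tested with the cut-off field `cutoff d n • sphGrad
  -- (polyFun Q)`. The boundary term becomes the `cutoffSlope` integral, which tends to 0 by
  -- dominated convergence, so no trace is needed.
  have key : ∀ n, -c * ∫ x : Sph d, cutoff d n x • (polyFun Q x * u x) ∂(hemiMeasure d)
      - ∫ x : Sph d, cutoffSlope d n x • (polyFun (polyEuler (Fin (d + 1)) Q) x * u x)
        ∂(hemiMeasure d)
      = - ∫ x : Sph d, cutoff d n x • ⟪sphGrad (polyFun Q) x, G x⟫ ∂(hemiMeasure d) := by
    intro n
    have hfield : IsTestField fun x => cutoff d n x • sphGrad (polyFun Q) x :=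
      ⟨isTest_cutoff_smul n (contDiff_sphGrad_polyFun Q),
        fun x => by rw [real_inner_smul_left, inner_sphGrad_self (norm_coe_sph x), mul_zero]⟩
    have h1 := hqw.2 _ hfield
    have h2 : ∀ x : Sph d, u x * sphDiv (fun x => cutoff d n x • sphGrad (polyFun Q) x) x
        = -c * (cutoff d n x • (polyFun Q x * u x))
          - cutoffSlope d n x • (polyFun (polyEuler (Fin (d + 1)) Q) x * u x) := fun x => by
      rw [sphDiv_cutoff_smul_sphGrad n hQ (norm_coe_sph x), hc, smul_eq_mul, smul_eq_mul]
      ring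
    have h3 : ∀ x : Sph d, ⟪G x, cutoff d n x • sphGrad (polyFun Q) x⟫
        = cutoff d n x • ⟪sphGrad (polyFun Q) x, G x⟫ := fun x => by
      rw [real_inner_smul_right, real_inner_comm, smul_eq_mul]
    simp only [h2, h3] at h1
    have i1 : Integrable (fun x : Sph d => cutoff d n x • (polyFun Q x * u x)) (hemiMeasure d) :=
      hI1.bdd_mul (c := 1) (hcm n) (hcb n)
    have i2 : Integrable (fun x : Sph d =>
        cutoffSlope d n x • (polyFun (polyEuler (Fin (d + 1)) Q) x * u x)) (hemiMeasure d) :=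
      hI2.bdd_mul (c := C) (hsm n) (hsb n)
    rwa [integral_sub (i1.const_mul _) i2, integral_const_mul] at h1
  have l1 := ((tendsto_integral_smul hI1 hcm hcb hcl).const_mul (-c)).sub
    (tendsto_integral_smul hI2 hsm hsb hsl)
  have l2 := (tendsto_integral_smul hI3 hcm hcb hcl).neg
  have := tendsto_nhds_unique (l1.congr key) l2
  simp only [one_smul, zero_smul, sub_zero] at this
  rw [inner_polyGradL2, inner_polyL2]
  linarith

/-- Polynomials that vanish on the equator are in `H¹₀`. -/
theorem polyL2_mem_sobolevH10 (R : MvPolynomial (Fin (d + 1)) ℝ) :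
    (polyL2 d (X (Fin.last d) * R), polyGradL2 (X (Fin.last d) * R)) ∈ sobolevH10 d := by
  set Q := X (Fin.last d) * R with hQ
  have hQx : ∀ x : Eucl (d + 1), polyFun Q x = x (Fin.last d) * polyFun R x := fun x => by
    simp [polyFun, hQ]
  obtain ⟨C, hC⟩ := exists_bound_mul_deriv_smoothStep
  have hsm : ∀ n, ContDiff ℝ ∞ fun x => cutoff d n x * polyFun Q x := fun n =>
    (contDiff_cutoff n).mul (contDiff_polyFun Q)
  -- Since Q = x_{d+1} R, the error Q ∇(cutoff) equals `cutoffSlope` times W; it is bounded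
  -- uniformly in n and tends to 0 pointwise on the hemisphere.
  let W : Eucl (d + 1) → Eucl (d + 1) := fun x =>
    polyFun R x • (EuclideanSpace.single (Fin.last d) 1 - x (Fin.last d) • x)
  have hW : Continuous W := by
    have := (contDiff_polyFun R).continuous
    fun_prop
  have hgrad : ∀ n, ∀ x : Sph d, sphGrad (fun x => cutoff d n x * polyFun Q x) x
      = cutoff d n x • sphGrad (polyFun Q) x + cutoffSlope d n x • W x := fun n x => by
    rw [sphGrad_mul ((contDiff_cutoff n).differentiable (by simp) _)
      ((contDiff_polyFun Q).differentiable (by simp) _), sphGrad_cutoff n (norm_coe_sph x), hQx,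
      cutoffSlope, smul_smul, smul_smul]
    congr 2
    ring
  have hGc : ∀ n, Continuous fun x : Eucl (d + 1) =>
      cutoff d n x • sphGrad (polyFun Q) x + cutoffSlope d n x • W x := fun n =>
    ((contDiff_cutoff n).continuous.smul (contDiff_sphGrad_polyFun Q).continuous).add
      ((continuous_cutoffSlope n).smul hW)
  obtain ⟨M₁, hM₁⟩ := exists_bound_sph (contDiff_polyFun Q).continuous
  obtain ⟨M₂, hM₂⟩ := exists_bound_sph (contDiff_sphGrad_polyFun Q).continuous
  obtain ⟨M₃, hM₃⟩ := exists_bound_sph hW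
  have hsub : ∀ n, ∀ x : Sph d, |cutoff d n x - 1| ≤ 2 := fun n x => by
    have := abs_le.1 (abs_cutoff_le_one n (x : Eucl (d + 1)))
    exact abs_le.2 ⟨by linarith, by linarith⟩
  have t1 := tendsto_toLp_of_bounded (μ := hemiMeasure d)
    (fun n => memLp_sph (hsm n).continuous) (memLp_sph (contDiff_polyFun Q).continuous)
    (C := 2 * M₁) (fun n => Eventually.of_forall fun x => by
      rw [← sub_one_mul, norm_mul]
      exact mul_le_mul (hsub n x) (hM₁ x) (norm_nonneg _) zero_le_two)
    (ae_mem_hemisphere.mono fun x hx => by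
      simpa using (tendsto_cutoff hx).mul_const (polyFun Q x))
  have t2 := tendsto_toLp_of_bounded (μ := hemiMeasure d)
    (fun n => memLp_sph (hGc n)) (memLp_sph (contDiff_sphGrad_polyFun Q).continuous)
    (C := 2 * M₂ + C * M₃) (fun n => Eventually.of_forall fun x => by
      rw [show ∀ a b c : Eucl (d + 1), a + b - c = (a - c) + b from fun a b c => by abel,
        show ∀ (r : ℝ) (v : Eucl (d + 1)), r • v - v = (r - 1) • v from fun r v => by module]
      refine (norm_add_le _ _).trans (add_le_add ?_ ?_)
      · rw [norm_smul]
        exact mul_le_mul (hsub n x) (hM₂ x) (norm_nonneg _) zero_le_two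
      · rw [norm_smul]
        exact mul_le_mul (hC _) (hM₃ x) (norm_nonneg _) ((abs_nonneg _).trans (hC 0)))
    (ae_mem_hemisphere.mono fun x hx => by
      simpa using ((tendsto_cutoff hx).smul_const (sphGrad (polyFun Q) (x : Eucl (d + 1)))).add
        ((tendsto_cutoffSlope hx).smul_const (W x)))
  refine mem_closure_of_tendsto (t1.prodMk_nhds t2) (Eventually.of_forall fun n => ?_)
  refine ⟨fun x => cutoff d n x * polyFun Q x, isTest_cutoff_smul n (contDiff_polyFun Q),
    (memLp_sph (hsm n).continuous).coeFn_toLp, ?_⟩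
  filter_upwards [(memLp_sph (hGc n)).coeFn_toLp] with x hx
  rw [hgrad]
  exact hx

/-- The form domain for the boundary condition `s`: Neumann for `s = 0`, Dirichlet for `s = 1`. -/
def formDomain (d : ℕ) : ℕ → Submodule ℝ (HemiL2 d × HemiL2Vec d)
  | 0 => sobolevH1 d
  | _ + 1 => sobolevH10 d

/-- Lifted eigenpolynomials are weak eigenfunctions. -/
theorem eigenPoly_mem_weakSolutions {s k : ℕ} (hd : 1 ≤ d) (hs : s ≤ 1)
    {p : MvPolynomial (Fin d) ℝ} (hp : p.IsHomogeneous k) :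
    (polyL2 d (hemiLift d s (eigenPoly d s k p)), polyGradL2 (hemiLift d s (eigenPoly d s k p)))
      ∈ weakSolutions (formDomain d s) (hemiEigenvalue d s k) := by
  have hc := fun x : Sph d => sphDiv_sphGrad_eigenPoly hd hs hp (norm_coe_sph x)
  -- For s = 0 the lift does not involve x_{d+1}, so its normal derivative vanishes; for s = 1 it
  -- has the factor x_{d+1} and lies in H¹₀.
  interval_cases s
  · refine ⟨isWeakGrad_polyL2 _, fun q hq => inner_polyGradL2_of_mem_sobolevH1 ?_ hq hc⟩
    rw [pderiv_last_hemiLift]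
    simp
  · refine ⟨?_, fun q hq => inner_polyGradL2_of_mem_sobolevH10 _ hq hc⟩
    rw [hemiLift_apply, pow_one]
    exact polyL2_mem_sobolevH10 _

end HemisphereWeyl
end

/-! ### Totality and injectivity of the lifts. -/

noncomputable section

namespace HemisphereWeyl

open MeasureTheory Filter Topology MvPolynomial

variable {d : ℕ}

section Completeness

/-- Stone–Weierstrass on the closed ball: the coordinates separate points. -/
theorem exists_polynomial_near {n : ℕ} {F : Metric.closedBall (0 : Eucl n) 1 → ℝ}
    (hF : Continuous F) {ε : ℝ} (hε : 0 < ε) :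
    ∃ p : MvPolynomial (Fin n) ℝ, ∀ y, |polyFun p y.1 - F y| < ε := by
  have : CompactSpace (Metric.closedBall (0 : Eucl n) 1) :=
    isCompact_iff_compactSpace.1 (isCompact_closedBall _ _)
  let coord : Fin n → C(Metric.closedBall (0 : Eucl n) 1, ℝ) := fun i => ⟨fun y => y.1 i, by fun_prop⟩
  let φ : MvPolynomial (Fin n) ℝ →ₐ[ℝ] C(Metric.closedBall (0 : Eucl n) 1, ℝ) := aeval coord
  have hφ : ∀ p y, φ p y = polyFun p y.1 := by
    intro p y
    induction p using MvPolynomial.induction_on with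
    | C a => simp [φ, polyFun]
    | add p q hp hq => simpa [polyFun] using congrArg₂ (· + ·) hp hq
    | mul_X p i hp =>
      simp only [map_mul, ContinuousMap.mul_apply, hp, polyFun, eval_X]
      simp [φ, coord]
  have hsep : φ.range.SeparatesPoints := by
    intro y y' hne
    obtain ⟨i, hi⟩ : ∃ i, y.1 i ≠ y'.1 i := by
      by_contra! h
      exact hne (Subtype.ext (PiLp.ext h))
    refine ⟨_, ⟨φ (X i), ⟨X i, rfl⟩, rfl⟩, ?_⟩
    change φ (X i) y ≠ φ (X i) y'
    rw [hφ, hφ]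
    simpa [polyFun] using hi
  obtain ⟨⟨g, p, rfl⟩, hp⟩ :=
    ContinuousMap.exists_mem_subalgebra_near_continuous_of_separatesPoints φ.range hsep F hF ε hε
  refine ⟨p, fun y => ?_⟩
  rw [← hφ]
  exact hp y

/-- The first `d` coordinates of a point. -/
def dropLast (x : Eucl (d + 1)) : Eucl d := WithLp.toLp 2 fun i => x i.castSucc

theorem norm_sq_eq_dropLast (x : Eucl (d + 1)) :
    ‖x‖ ^ 2 = ‖dropLast x‖ ^ 2 + x (Fin.last d) ^ 2 := by
  simp [EuclideanSpace.norm_sq_eq, Fin.sum_univ_castSucc, dropLast]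

theorem polyFun_hemiLift (s : ℕ) (p : MvPolynomial (Fin d) ℝ) (x : Eucl (d + 1)) :
    polyFun (hemiLift d s p) x = x (Fin.last d) ^ s * polyFun p (dropLast x) := by
  simp [polyFun, hemiLift_apply, eval_rename, dropLast, Function.comp_def]

/-- The graph parametrization of the closed upper half sphere. -/
def graphPoint (y : Eucl d) : Eucl (d + 1) :=
  WithLp.toLp 2 (Fin.snoc (α := fun _ => ℝ) (fun i => y i) (Real.sqrt (1 - ‖y‖ ^ 2)))

theorem continuous_graphPoint : Continuous (graphPoint (d := d)) := by
  refine (PiLp.continuous_toLp 2 _).comp (continuous_pi fun i => ?_)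
  refine Fin.lastCases ?_ (fun j => ?_) i
  · simp only [Fin.snoc_last]
    fun_prop
  · simp only [Fin.snoc_castSucc]
    fun_prop

theorem graphPoint_last (y : Eucl d) :
    graphPoint y (Fin.last d) = Real.sqrt (1 - ‖y‖ ^ 2) := by
  simp [graphPoint]

theorem dropLast_graphPoint (y : Eucl d) : dropLast (graphPoint y) = y := by
  ext i
  simp [graphPoint, dropLast]

theorem norm_graphPoint {y : Eucl d} (hy : ‖y‖ ≤ 1) : ‖graphPoint y‖ = 1 := by
  have h := norm_sq_eq_dropLast (graphPoint y)
  have h1 : ‖y‖ ^ 2 ≤ 1 := pow_le_one₀ (norm_nonneg _) hy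
  rw [dropLast_graphPoint, graphPoint_last, Real.sq_sqrt (by linarith)] at h
  exact (sq_eq_sq₀ (norm_nonneg _) zero_le_one).1 (by linarith)

theorem graphPoint_dropLast {x : Sph d} (hx : x ∈ hemisphere d) :
    graphPoint (dropLast (x : Eucl (d + 1))) = x := by
  have h := norm_sq_eq_dropLast (x : Eucl (d + 1))
  rw [norm_coe_sph] at h
  ext i
  refine Fin.lastCases ?_ (fun j => ?_) i
  · rw [graphPoint_last, show 1 - ‖dropLast (x : Eucl (d + 1))‖ ^ 2
      = (x : Eucl (d + 1)) (Fin.last d) ^ 2 by linarith]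
    exact Real.sqrt_sq (le_of_lt hx)
  · simp [graphPoint, dropLast]

theorem norm_dropLast_le_one (x : Sph d) : ‖dropLast (x : Eucl (d + 1))‖ ≤ 1 := by
  have h := norm_sq_eq_dropLast (x : Eucl (d + 1))
  rw [norm_coe_sph] at h
  nlinarith [norm_nonneg (dropLast (x : Eucl (d + 1))), sq_nonneg ((x : Eucl (d + 1)) (Fin.last d))]

theorem continuous_dropLast : Continuous (dropLast (d := d)) := by
  unfold dropLast
  fun_prop

/-- Polynomials in the tangential coordinates are total in `L²(S^d_+)`. -/
theorem eq_zero_of_orthogonal_polynomials {v : HemiL2 d}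
    (h : ∀ p : MvPolynomial (Fin d) ℝ,
      ∫ x : Sph d, polyFun p (dropLast (x : Eucl (d + 1))) * v x ∂(hemiMeasure d) = 0) : v = 0 := by
  have hv : Integrable v (hemiMeasure d) := (Lp.memLp v).integrable one_le_two
  have hcont : ∀ f : C(Sph d, ℝ), ∫ x, f x * v x ∂(hemiMeasure d) = 0 := by
    intro f
    set N := ∫ x, ‖v x‖ ∂(hemiMeasure d) with hN
    have hN0 : 0 ≤ N := integral_nonneg fun x => norm_nonneg _
    -- Through the graph parametrization f becomes a continuous function on the closed ball, where
    -- polynomials approximate it uniformly.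
    have hF : Continuous fun y : Metric.closedBall (0 : Eucl d) 1 => f ⟨graphPoint y.1, by
        simpa using norm_graphPoint (mem_closedBall_zero_iff.1 y.2)⟩ :=
      f.continuous.comp ((continuous_graphPoint.comp continuous_subtype_val).subtype_mk _)
    have hle : ∀ ε > 0, |∫ x, f x * v x ∂(hemiMeasure d)| ≤ ε * N := by
      intro ε hε
      obtain ⟨p, hp⟩ := exists_polynomial_near hF hε
      have hpc : Continuous fun x : Sph d => polyFun p (dropLast (x : Eucl (d + 1))) :=
        (contDiff_polyFun p).continuous.comp (continuous_dropLast.comp continuous_subtype_val)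
      have hint : ∀ g : Sph d → ℝ, Continuous g →
          Integrable (fun x => g x * v x) (hemiMeasure d) := fun g hg => by
        obtain ⟨M, hM⟩ := (isCompact_univ (X := Sph d)).exists_bound_of_continuousOn hg.continuousOn
        exact hv.bdd_mul (c := M) hg.aestronglyMeasurable
          (Eventually.of_forall fun x => hM x trivial)
      have h1 : ∫ x, f x * v x ∂(hemiMeasure d)
          = ∫ x : Sph d, (f x * v x - polyFun p (dropLast (x : Eucl (d + 1))) * v x)
            ∂(hemiMeasure d) := by
        rw [integral_sub (hint f f.continuous) (hint _ hpc), h p, sub_zero]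
      rw [h1, ← Real.norm_eq_abs, hN, ← integral_const_mul]
      refine norm_integral_le_of_norm_le (hv.norm.const_mul ε) ?_
      filter_upwards [ae_mem_hemisphere] with x hx
      rw [← sub_mul, norm_mul]
      refine mul_le_mul_of_nonneg_right ?_ (norm_nonneg _)
      have h2 := hp ⟨dropLast (x : Eucl (d + 1)),
        mem_closedBall_zero_iff.2 (norm_dropLast_le_one x)⟩
      simp only [graphPoint_dropLast hx] at h2
      rw [norm_sub_rev]
      exact h2.le
    by_contra hI
    have hI' := abs_pos.2 hI
    -- For a nonzero integral I, taking ε = |I|/(N+1) would give |I|(N+1) ≤ |I|N; the added 1 also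
    -- covers N = 0.
    have h3 := hle (|∫ x, f x * v x ∂(hemiMeasure d)| / (N + 1)) (by positivity)
    rw [div_mul_eq_mul_div, le_div_iff₀ (by positivity)] at h3
    linarith
  have hin : ∀ w : HemiL2 d, ⟪w, v⟫ = 0 := by
    intro w
    refine (ContinuousMap.toLp_denseRange ℝ (hemiMeasure d) ℝ
      (p := 2) ENNReal.ofNat_ne_top).induction_on (p := fun w => ⟪w, v⟫ = 0) w
      (isClosed_eq (by fun_prop) continuous_const) fun f => ?_
    rw [← hcont f, L2.inner_def]
    refine integral_congr_ae ?_
    filter_upwards [ContinuousMap.coeFn_toLp (p := 2) (𝕜 := ℝ) (hemiMeasure d) f] with x hx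
    rw [hx]
    simp [mul_comm]
  exact inner_self_eq_zero.1 (hin v)

theorem abs_last_le_one (x : Sph d) : |(x : Eucl (d + 1)) (Fin.last d)| ≤ 1 := by
  exact (PiLp.norm_apply_le (x : Eucl (d + 1)) (Fin.last d)).trans_eq (norm_coe_sph x)

/-- The lifted eigenpolynomials are total in `L²(S^d_+)`. -/
theorem eq_zero_of_orthogonal_eigenPoly {s : ℕ} {u : HemiL2 d}
    (h : ∀ k p, p.IsHomogeneous k → ⟪polyL2 d (hemiLift d s (eigenPoly d s k p)), u⟫ = 0) :
    u = 0 := by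
  have hΛ := eq_zero_of_eigenPoly (s := s)
    (Λ := (innerSL ℝ u).toLinearMap ∘ₗ polyL2 d ∘ₗ hemiLift d s) fun k p hp => by
      simpa [real_inner_comm] using h k p hp
  have h0 : ∀ p : MvPolynomial (Fin d) ℝ, ⟪polyL2 d (hemiLift d s p), u⟫ = 0 := fun p => by
    have := LinearMap.congr_fun hΛ p
    simpa [real_inner_comm] using this
  have hc : Continuous fun x : Eucl (d + 1) => x (Fin.last d) ^ s := by fun_prop
  -- The factor x_{d+1}^s is moved from the lift onto u. The product is orthogonal to all tangential
  -- polynomials, hence zero, and u is recovered because x_{d+1} > 0.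
  have hvm : MemLp (fun x : Sph d => (x : Eucl (d + 1)) (Fin.last d) ^ s * u x) 2
      (hemiMeasure d) := by
    refine (Lp.memLp u).of_le ((aestronglyMeasurable_sph hc).mul (Lp.memLp u).1)
      (Eventually.of_forall fun x => ?_)
    rw [norm_mul, norm_pow]
    exact mul_le_of_le_one_left (norm_nonneg _) (pow_le_one₀ (norm_nonneg _) (abs_last_le_one x))
  have hv : hvm.toLp = 0 := by
    refine eq_zero_of_orthogonal_polynomials fun p => ?_
    rw [← h0 p, inner_polyL2]
    refine integral_congr_ae ?_
    filter_upwards [hvm.coeFn_toLp] with x hx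
    rw [hx, polyFun_hemiLift]
    ring
  refine (Lp.eq_zero_iff_ae_eq_zero).2 ?_
  filter_upwards [hvm.coeFn_toLp, ae_mem_hemisphere,
    (Lp.eq_zero_iff_ae_eq_zero (f := hvm.toLp)).1 hv] with x h1 hx h2
  rw [h2] at h1
  exact (mul_eq_zero.1 h1.symm).resolve_left (pow_ne_zero _ (ne_of_gt hx))

end Completeness

section Injectivity

/-- A continuous function that vanishes almost everywhere on an open set vanishes there, since the
surface measure charges every nonempty open set. -/
theorem eqOn_hemisphere_of_polyL2_eq_zero {Q : MvPolynomial (Fin (d + 1)) ℝ}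
    (hQ : polyL2 d Q = 0) {x : Sph d} (hx : x ∈ hemisphere d) : polyFun Q x = 0 := by
  have h1 : (fun x : Sph d => polyFun Q x) =ᵐ[hemiMeasure d] fun _ => 0 := by
    filter_upwards [coeFn_polyL2 Q, (Lp.eq_zero_iff_ae_eq_zero).1 hQ] with y h1 h2
    rw [← h1, h2]
    rfl
  exact Measure.eqOn_open_of_ae_eq h1 isOpen_hemisphere
    ((contDiff_polyFun Q).continuous.comp continuous_subtype_val).continuousOn
    continuousOn_const hx

theorem polyL2_hemiLift_injective (s : ℕ) :
    Function.Injective (polyL2 d ∘ₗ hemiLift d s) := by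
  refine (injective_iff_map_eq_zero _).2 fun p hp => ?_
  have hpos : (0 : ℝ) < 1 / (d + 1) := by positivity
  -- A polynomial is determined by its values on a product of infinite sets. The side 1/(d+1) keeps
  -- the cube in the open ball, as the d squares add up to at most d/(d+1).
  refine MvPolynomial.funext_set (fun _ => Set.Ioo 0 (1 / ((d : ℝ) + 1)))
    (fun _ => Set.Ioo_infinite hpos) fun y hy => ?_
  have hy' : ∀ i, 0 < y i ∧ y i < 1 / ((d : ℝ) + 1) := fun i => hy i trivial
  have hn : ‖(WithLp.toLp 2 y : Eucl d)‖ ^ 2 < 1 := by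
    rw [EuclideanSpace.norm_sq_eq]
    have hle : ∀ i ∈ Finset.univ, ‖(WithLp.toLp 2 y : Eucl d) i‖ ^ 2 ≤ 1 / ((d : ℝ) + 1) :=
      fun i _ => by
        have h1 : 1 / ((d : ℝ) + 1) ≤ 1 := by
          rw [div_le_one (by positivity)]
          linarith [d.cast_nonneg (α := ℝ)]
        rw [Real.norm_eq_abs, sq_abs]
        have := hy' i
        change y i ^ 2 ≤ _
        nlinarith
    refine (Finset.sum_le_sum hle).trans_lt ?_
    rw [Finset.sum_const, Finset.card_univ, Fintype.card_fin, nsmul_eq_mul, mul_one_div,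
      div_lt_one (by positivity)]
    linarith
  have hn1 : ‖(WithLp.toLp 2 y : Eucl d)‖ ≤ 1 := by nlinarith [norm_nonneg (WithLp.toLp 2 y : Eucl d)]
  have hlast : 0 < graphPoint (WithLp.toLp 2 y : Eucl d) (Fin.last d) := by
    rw [graphPoint_last]
    exact Real.sqrt_pos.2 (by linarith)
  have h := eqOn_hemisphere_of_polyL2_eq_zero hp
    (x := ⟨graphPoint (WithLp.toLp 2 y), by simpa using norm_graphPoint hn1⟩) hlast
  rw [polyFun_hemiLift] at h
  simpa [dropLast_graphPoint, polyFun] using (mul_eq_zero.1 h).resolve_left (pow_ne_zero _ hlast.ne')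

end Injectivity

end HemisphereWeyl
end

/-! ### Eigenspaces and the closed form of the counting functions. -/

noncomputable section

namespace HemisphereWeyl

open MeasureTheory Filter Topology MvPolynomial

variable {d : ℕ}

/-- The map from leading parts to eigenfunctions. -/
def eigenMap (d s k : ℕ) : homogeneousSubmodule (Fin d) ℝ k →ₗ[ℝ] HemiL2 d :=
  (polyL2 d ∘ₗ hemiLift d s) ∘ₗ eigenPoly d s k ∘ₗ (homogeneousSubmodule (Fin d) ℝ k).subtype

theorem eigenMap_injective (d s k : ℕ) : Function.Injective (eigenMap d s k) := by
  refine (polyL2_hemiLift_injective s).comp fun p q h => Subtype.ext ?_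
  have := congrArg (homogeneousComponent k) h
  simp only [LinearMap.comp_apply, Submodule.subtype_apply] at this
  rwa [homogeneousComponent_eigenPoly p.2, homogeneousComponent_eigenPoly q.2] at this

instance (d k : ℕ) : Module.Finite ℝ (homogeneousSubmodule (Fin d) ℝ k) :=
  Module.Finite.iff_fg.2 (homogeneousSubmodule_fg (Fin d) ℝ k)

/-- Symmetry of the form: testing the two weak equations against each other gives (lam - λ_k)⟪Y, u⟫
= 0 for the eigenfunction Y. -/
theorem inner_eigenMap_of_ne {s k : ℕ} (hd : 1 ≤ d) (hs : s ≤ 1) {lam : ℝ}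
    (hne : lam ≠ hemiEigenvalue d s k) (p : homogeneousSubmodule (Fin d) ℝ k) {u : HemiL2 d}
    (hu : u ∈ weakEigenspace (formDomain d s) lam) : ⟪eigenMap d s k p, u⟫ = 0 := by
  obtain ⟨⟨u, G⟩, ⟨hV, hG⟩, rfl⟩ := hu
  obtain ⟨hV', hY⟩ := eigenPoly_mem_weakSolutions hd hs p.2
  have h1 := hG _ hV'
  have h2 := hY _ hV
  simp only at h1 h2
  rw [real_inner_comm, h2, real_inner_comm (polyL2 d _) u] at h1
  have h3 : (lam - hemiEigenvalue d s k) * ⟪eigenMap d s k p, u⟫ = 0 := by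
    change (lam - hemiEigenvalue d s k) * ⟪polyL2 d (hemiLift d s (eigenPoly d s k p)), u⟫ = 0
    linarith
  exact (mul_eq_zero.1 h3).resolve_left (sub_ne_zero.2 hne)

theorem range_eigenMap_le {s k : ℕ} (hd : 1 ≤ d) (hs : s ≤ 1) :
    LinearMap.range (eigenMap d s k)
      ≤ weakEigenspace (formDomain d s) (hemiEigenvalue d s k) := by
  rintro _ ⟨p, rfl⟩
  exact ⟨_, eigenPoly_mem_weakSolutions hd hs p.2, rfl⟩

theorem weakEigenspace_eq_bot {s : ℕ} (hd : 1 ≤ d) (hs : s ≤ 1) {lam : ℝ}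
    (hne : ∀ k, lam ≠ hemiEigenvalue d s k) : weakEigenspace (formDomain d s) lam = ⊥ :=
  (Submodule.eq_bot_iff _).2 fun _ hu => eq_zero_of_orthogonal_eigenPoly fun k p hp =>
    inner_eigenMap_of_ne hd hs (hne k) ⟨p, hp⟩ hu

/-- Subtracting from u its projection onto the finite-dimensional range leaves an element of the
same eigenspace. It is orthogonal to the range, and to the other families by the distinctness of the
eigenvalues, so it vanishes by totality. -/
theorem weakEigenspace_hemiEigenvalue {s : ℕ} (hd : 1 ≤ d) (hs : s ≤ 1) (k : ℕ) :
    weakEigenspace (formDomain d s) (hemiEigenvalue d s k) = LinearMap.range (eigenMap d s k) := by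
  refine le_antisymm (fun u hu => ?_) (range_eigenMap_le hd hs)
  set W := LinearMap.range (eigenMap d s k) with hW
  have hPW : W.starProjection u ∈ W := Submodule.starProjection_apply_mem W u
  have h0 : u - W.starProjection u = 0 := by
    refine eq_zero_of_orthogonal_eigenPoly (s := s) fun j p hp => ?_
    by_cases hj : j = k
    · subst hj
      exact (W.sub_starProjection_mem_orthogonal u) _ ⟨⟨p, hp⟩, rfl⟩
    · exact inner_eigenMap_of_ne hd hs
        ((hemiEigenvalue_strictMono hd s).injective.ne (Ne.symm hj)) ⟨p, hp⟩
        (Submodule.sub_mem _ hu (range_eigenMap_le hd hs hPW))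
  rw [sub_eq_zero.1 h0]
  exact hPW

theorem toENat_rank_weakEigenspace {n s : ℕ} (hs : s ≤ 1) (k : ℕ) :
    Cardinal.toENat (Module.rank ℝ
      (weakEigenspace (formDomain (n + 1) s) (hemiEigenvalue (n + 1) s k)))
      = ((k + n).choose n : ℕ) := by
  rw [weakEigenspace_hemiEigenvalue n.succ_pos hs, ← Module.finrank_eq_rank,
    LinearMap.finrank_range_of_inj (eigenMap_injective _ _ _), finrank_homogeneousSubmodule]
  simp

/-- The counting function is a sum of multiplicities. -/
theorem eigenCount_eq_sum {n s : ℕ} (hs : s ≤ 1) {z : ℝ} {K : Finset ℕ}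
    (hK : ∀ k, k ∈ K ↔ hemiEigenvalue (n + 1) s k ≤ z) :
    eigenCount (formDomain (n + 1) s) z = ((∑ k ∈ K, (k + n).choose n : ℕ) : ℝ≥0∞) := by
  classical
  have hinj := (hemiEigenvalue_strictMono (d := n + 1) n.succ_pos s).injective
  set f : ℝ → ℝ≥0∞ := fun lam => ((Cardinal.toENat (Module.rank ℝ
    (weakEigenspace (formDomain (n + 1) s) lam)) : ℕ∞) : ℝ≥0∞) with hf
  have h1 : eigenCount (formDomain (n + 1) s) z = ∑' lam : Set.Iic z, f lam := rfl
  -- The sum over all real numbers up to z is supported on the finitely many explicit eigenvalues.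
  rw [h1, tsum_subtype, tsum_eq_sum (s := K.image (hemiEigenvalue (n + 1) s)),
    Finset.sum_image hinj.injOn, Nat.cast_sum]
  · refine Finset.sum_congr rfl fun k hk => ?_
    rw [Set.indicator_of_mem (Set.mem_Iic.2 ((hK k).1 hk))]
    simp only [hf]
    rw [toENat_rank_weakEigenspace hs]
    simp
  · intro lam hlam
    by_cases hz : lam ∈ Set.Iic z
    · rw [Set.indicator_of_mem hz]
      simp only [hf]
      rw [weakEigenspace_eq_bot n.succ_pos hs]
      · simp
      · rintro k rfl
        exact hlam (Finset.mem_image_of_mem _ ((hK k).2 hz))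
    · rw [Set.indicator_of_notMem hz]

/-- Rests on k ≤ λ_k rather than on the closed form, so that negative z is covered. -/
theorem eigenCount_ne_top {n s : ℕ} (hs : s ≤ 1) (z : ℝ) :
    eigenCount (formDomain (n + 1) s) z ≠ ⊤ := by
  have hfin : {k : ℕ | hemiEigenvalue (n + 1) s k ≤ z}.Finite := by
    refine (Set.finite_Iic ⌈z⌉₊).subset fun k hk => ?_
    have h1 : (k : ℝ) ≤ hemiEigenvalue (n + 1) s k := by
      unfold hemiEigenvalue
      rcases Nat.eq_zero_or_pos k with rfl | h
      · push_cast
        have : (0 : ℝ) ≤ s := s.cast_nonneg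
        have : (0 : ℝ) ≤ n := n.cast_nonneg
        nlinarith [mul_nonneg (s.cast_nonneg (α := ℝ)) (n.cast_nonneg (α := ℝ))]
      · have : (1 : ℝ) ≤ k := by exact_mod_cast h
        have : (0 : ℝ) ≤ s := s.cast_nonneg
        have : (0 : ℝ) ≤ n := n.cast_nonneg
        push_cast
        nlinarith
    exact Nat.cast_le.1 ((h1.trans hk).trans (Nat.le_ceil z))
  rw [eigenCount_eq_sum hs (K := hfin.toFinset) (by simp)]
  exact ENNReal.natCast_ne_top _

/-- The hockey-stick identity, which makes the count a single binomial and hence a product of linear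
factors. -/
theorem sum_range_add_choose (n M : ℕ) :
    ∑ k ∈ Finset.range M, (k + n).choose n = (M + n).choose (n + 1) := by
  induction M with
  | zero => simp
  | succ M ih =>
    rw [Finset.sum_range_succ, ih, show M + 1 + n = (M + n) + 1 by ring, Nat.choose_succ_succ,
      add_comm]

theorem hemiEigenvalue_le_iff {n s k : ℕ} {w : ℝ} (hw : 0 ≤ w) :
    hemiEigenvalue (n + 1) s k ≤ w * (w + ((n + 1 : ℕ) : ℝ) - 1) ↔ k + s ≤ ⌊w⌋₊ := by
  rw [Nat.le_floor_iff hw]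
  unfold hemiEigenvalue
  push_cast
  have hn : (0 : ℝ) ≤ n := n.cast_nonneg
  have hx : (0 : ℝ) ≤ k + s := by positivity
  constructor
  · intro h
    by_contra! hlt
    nlinarith
  · intro h
    nlinarith

/-- The counting functions in closed form. -/
theorem eigenCount_eq_choose {n s : ℕ} (hs : s ≤ 1) {z w : ℝ} (hw : 0 ≤ w)
    (hz : w * (w + ((n + 1 : ℕ) : ℝ) - 1) = z) :
    eigenCount (formDomain (n + 1) s) z = ((⌊w⌋₊ + 1 - s + n).choose (n + 1) : ℕ) := by
  -- The condition k + s ≤ ⌊w⌋ leaves `⌊w⌋₊ + 1 - s` values of k; the subtraction is exact because s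
  -- ≤ 1.
  rw [eigenCount_eq_sum hs (K := Finset.range (⌊w⌋₊ + 1 - s)), sum_range_add_choose]
  intro k
  rw [← hz, hemiEigenvalue_le_iff hw, Finset.mem_range]
  omega

end HemisphereWeyl
end

noncomputable section

namespace HemisphereWeyl

open MeasureTheory Filter Topology Asymptotics

/-! ### Sphere areas and the semiclassical constants. -/

section Areas

theorem toSphere_real_univ (m : ℕ) :
    ((volume : Measure (Eucl (m + 1))).toSphere).real Set.univ
      = 2 * √Real.pi ^ (m + 1) / Real.Gamma (((m : ℝ) + 1) / 2) := by
  rw [Measure.toSphere_real_apply_univ, measureReal_def, EuclideanSpace.volume_ball]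
  have h : (0 : ℝ) < ((m : ℝ) + 1) / 2 := by positivity
  have hG := Real.Gamma_pos_of_pos h
  simp only [finrank_euclideanSpace, Fintype.card_fin, ENNReal.ofReal_one, one_pow, one_mul]
  push_cast
  rw [Real.Gamma_add_one h.ne', ENNReal.toReal_ofReal (by positivity)]
  field_simp

theorem semiclassicalConst_zero (m : ℕ) :
    semiclassicalConst 0 m = ((2 * √Real.pi) ^ m * Real.Gamma ((m : ℝ) / 2 + 1))⁻¹ := by
  have h : (4 * Real.pi) = (2 * √Real.pi) ^ (2 : ℝ) := by
    rw [Real.rpow_two, mul_pow, Real.sq_sqrt Real.pi_pos.le]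
    norm_num
  rw [semiclassicalConst, h, ← Real.rpow_mul (by positivity),
    show (2 : ℝ) * -((m : ℝ) / 2) = -(m : ℝ) by ring, Real.rpow_neg (by positivity),
    Real.rpow_natCast, zero_add, Real.Gamma_one, mul_one, mul_inv, add_comm, div_eq_mul_inv]

/-- Legendre's duplication formula collapses the two Gamma values into a factorial. -/
theorem semiclassicalConst_mul_sphereArea (m : ℕ) :
    semiclassicalConst 0 m * ((volume : Measure (Eucl (m + 1))).toSphere).real Set.univ
      = 2 / (m.factorial : ℝ) := by
  have hL := Real.Gamma_mul_Gamma_add_half (((m : ℝ) + 1) / 2)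
  rw [show ((m : ℝ) + 1) / 2 + 1 / 2 = (m : ℝ) / 2 + 1 by ring,
    show 2 * (((m : ℝ) + 1) / 2) = (m : ℝ) + 1 by ring, Real.Gamma_nat_eq_factorial,
    show 1 - ((m : ℝ) + 1) = -(m : ℝ) by ring, Real.rpow_neg zero_le_two, Real.rpow_natCast] at hL
  have h1 : 0 < Real.Gamma (((m : ℝ) + 1) / 2) := Real.Gamma_pos_of_pos (by positivity)
  have h2 : 0 < Real.Gamma ((m : ℝ) / 2 + 1) := Real.Gamma_pos_of_pos (by positivity)
  have hπ : 0 < √Real.pi := Real.sqrt_pos.2 Real.pi_pos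
  have hf : (0 : ℝ) < m.factorial := by exact_mod_cast m.factorial_pos
  have h3 : √Real.pi * m.factorial
      = 2 ^ m * (Real.Gamma (((m : ℝ) + 1) / 2) * Real.Gamma ((m : ℝ) / 2 + 1)) := by
    rw [hL]
    field_simp
  rw [semiclassicalConst_zero, toSphere_real_univ, inv_mul_eq_div, div_div,
    div_eq_div_iff (by positivity) hf.ne']
  calc 2 * √Real.pi ^ (m + 1) * (m.factorial : ℝ)
      = 2 * √Real.pi ^ m * (√Real.pi * m.factorial) := by ring
    _ = _ := by rw [h3]; ring

variable {d : ℕ}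

theorem toSphere_neg_image (s : Set (Sph d)) (hs : MeasurableSet s) :
    ((volume : Measure (Eucl (d + 1))).toSphere) (Neg.neg ⁻¹' s)
      = ((volume : Measure (Eucl (d + 1))).toSphere) s := by
  rw [Measure.toSphere_apply' _ (hs.preimage continuous_neg.measurable),
    Measure.toSphere_apply' _ hs]
  congr 1
  rw [← Measure.measure_neg]
  congr 1
  ext x
  simp only [Set.mem_neg, Set.mem_smul, Set.mem_image, Set.mem_preimage]
  constructor
  · rintro ⟨r, hr, _, ⟨y, hy, rfl⟩, h⟩
    exact ⟨r, hr, _, ⟨-y, hy, rfl⟩, by simp [h]⟩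
  · rintro ⟨r, hr, _, ⟨y, hy, rfl⟩, h⟩
    exact ⟨r, hr, _, ⟨-y, by simpa using hy, rfl⟩, by simp [h]⟩

/-- The cone over the equator lies in a hyperplane, which is Lebesgue null. -/
theorem toSphere_equator : ((volume : Measure (Eucl (d + 1))).toSphere)
    {x : Sph d | (x : Eucl (d + 1)) (Fin.last d) = 0} = 0 := by
  have hm : MeasurableSet {x : Sph d | (x : Eucl (d + 1)) (Fin.last d) = 0} :=
    (isClosed_eq ((contDiff_coord (Fin.last d)).continuous.comp continuous_subtype_val)
      continuous_const).measurableSet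
  rw [Measure.toSphere_apply' _ hm]
  let V : Submodule ℝ (Eucl (d + 1)) := LinearMap.ker (EuclideanSpace.proj (𝕜 := ℝ) (Fin.last d) :
    Eucl (d + 1) →L[ℝ] ℝ).toLinearMap
  have hV : V ≠ ⊤ := by
    intro h
    have h1 : EuclideanSpace.single (Fin.last d) (1 : ℝ) ∈ V := h ▸ Submodule.mem_top
    simp [V] at h1
  have h0 := Measure.addHaar_submodule (volume : Measure (Eucl (d + 1))) V hV
  rw [measure_mono_null _ h0, mul_zero]
  rintro _ ⟨r, -, _, ⟨y, hy, rfl⟩, rfl⟩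
  have : (y : Eucl (d + 1)) (Fin.last d) = 0 := hy
  simp [V, this]

/-- The antipodal map preserves the measure and exchanges the two open hemispheres; the equator is
null. -/
theorem two_mul_hemiArea :
    2 * hemiArea d = ((volume : Measure (Eucl (d + 1))).toSphere).real Set.univ := by
  set σ := (volume : Measure (Eucl (d + 1))).toSphere with hσ
  have hA : hemiArea d = σ.real (hemisphere d) := by
    rw [hemiArea, hemiMeasure, measureReal_restrict_apply_univ]
  have hm := (isOpen_hemisphere (d := d)).measurableSet
  have h1 : σ.real (hemisphere d)ᶜ = σ.real (hemisphere d) := by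
    rw [measureReal_def, measureReal_def, ← toSphere_neg_image _ hm]
    congr 1
    refine measure_congr ?_
    have h0 : ∀ᵐ x : Sph d ∂σ, (x : Eucl (d + 1)) (Fin.last d) ≠ 0 := by
      rw [ae_iff]
      simpa using toSphere_equator (d := d)
    filter_upwards [h0] with x hx
    refine propext ?_
    change ¬ (0 < (x : Eucl (d + 1)) (Fin.last d)) ↔ 0 < (-(x : Eucl (d + 1))) (Fin.last d)
    rw [PiLp.neg_apply, neg_pos, not_lt]
    exact ⟨fun h => lt_of_le_of_ne h hx, le_of_lt⟩
  rw [hA, ← measureReal_add_measureReal_compl hm, h1]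
  ring

theorem semiclassicalConst_mul_hemiArea (d : ℕ) :
    semiclassicalConst 0 d * hemiArea d = (d.factorial : ℝ)⁻¹ := by
  have h := semiclassicalConst_mul_sphereArea d
  rw [← two_mul_hemiArea] at h
  rw [div_eq_mul_inv] at h
  linarith

/-- Makes the two forms of each expansion equivalent: the geometric boundary coefficient is d/2. -/
theorem quarter_ratio (n : ℕ) :
    1 / 4 * (semiclassicalConst 0 (((n + 1 : ℕ) : ℝ) - 1) / semiclassicalConst 0 ((n + 1 : ℕ) : ℝ))
      * (equatorArea (n + 1) / hemiArea (n + 1)) = ((n + 1 : ℕ) : ℝ) / 2 := by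
  have h1 := semiclassicalConst_mul_sphereArea n
  have h2 := semiclassicalConst_mul_hemiArea (n + 1)
  have hf : (0 : ℝ) < n.factorial := by exact_mod_cast n.factorial_pos
  rw [show ((n + 1 : ℕ) : ℝ) - 1 = n by push_cast; ring]
  calc _ = 1 / 4 * ((semiclassicalConst 0 n * equatorArea (n + 1))
      / (semiclassicalConst 0 ((n + 1 : ℕ) : ℝ) * hemiArea (n + 1))) := by ring
    _ = _ := by
      rw [h2, equatorArea, h1, Nat.factorial_succ]
      push_cast
      field_simp
      norm_num

end Areas

/-! ### Asymptotic expansion of the closed form. -/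

section Expansion

theorem isBigO_one_mul {l : Filter ℝ} {f g : ℝ → ℝ} (hf : f =O[l] fun _ => (1 : ℝ))
    (hg : g =O[l] fun _ => (1 : ℝ)) : (fun z => f z * g z) =O[l] fun _ => (1 : ℝ) := by
  simpa using hf.mul hg

/-- Second order expansion of a product of factors `1 + (c + j) ε + γ ε² + O(ε³)`. -/
theorem isBigO_prod_expansion {l : Filter ℝ} {ε c : ℝ → ℝ} {γ : ℝ} {f : ℕ → ℝ → ℝ}
    (hε : ε =O[l] fun _ => (1 : ℝ)) (hc : c =O[l] fun _ => (1 : ℝ))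
    (hf : ∀ j, (fun z => f j z - (1 + (c z + j) * ε z + γ * ε z ^ 2)) =O[l] fun z => ε z ^ 3)
    (m : ℕ) :
    (fun z => ∏ j ∈ Finset.range m, f j z
      - (1 + (m * c z + m * (m - 1) / 2) * ε z
        + (m * γ + m * (m - 1) / 2 * c z ^ 2 + c z * (m - 1) * (m * (m - 1) / 2)
          + m * (m - 1) * (m - 2) * (3 * m - 1) / 24) * ε z ^ 2)) =O[l] fun z => ε z ^ 3 := by
  have hk : ∀ r : ℝ, (fun _ : ℝ => r) =O[l] fun _ => (1 : ℝ) := fun r => isBigO_const_const r one_ne_zero l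
  have hε2 : (fun z => ε z ^ 2) =O[l] fun _ => (1 : ℝ) := by simpa using hε.pow 2
  have hε3 : (fun z => ε z ^ 3) =O[l] fun _ => (1 : ℝ) := by simpa using hε.pow 3
  have hc2 : (fun z => c z ^ 2) =O[l] fun _ => (1 : ℝ) := by simpa using hc.pow 2
  have hS : ∀ m : ℕ, (fun z => (m : ℝ) * c z + m * (m - 1) / 2) =O[l] fun _ => (1 : ℝ) := fun m =>
    (isBigO_one_mul (hk _) hc).add (hk _)
  -- The ε² coefficient is mγ + e₂(c, c+1, …, c+m-1), where e₂ is the second elementary symmetric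
  -- function and e₂(0, …, m-1) = m(m-1)(m-2)(3m-1)/24.
  have hQ : ∀ m : ℕ, (fun z => (m : ℝ) * γ + m * (m - 1) / 2 * c z ^ 2
      + c z * (m - 1) * (m * (m - 1) / 2)
      + m * (m - 1) * (m - 2) * (3 * m - 1) / 24) =O[l] fun _ => (1 : ℝ) := fun m =>
    (((hk _).add (isBigO_one_mul (hk _) hc2)).add
      (isBigO_one_mul (isBigO_one_mul hc (hk _)) (hk _))).add (hk _)
  induction m with
  | zero =>
    have h0 : (fun _ => (0 : ℝ)) =O[l] fun z => ε z ^ 3 := isBigO_zero _ _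
    exact h0.congr_left fun z => by simp
  | succ m ih =>
    have hB : (fun z => 1 + (c z + m) * ε z + γ * ε z ^ 2) =O[l] fun _ => (1 : ℝ) :=
      ((hk 1).add (isBigO_one_mul (hc.add (hk _)) hε)).add (isBigO_one_mul (hk _) hε2)
    have hfm : f m =O[l] fun _ => (1 : ℝ) := by
      simpa using ((hf m).trans hε3).add hB
    have hA := ((hk 1).add (isBigO_one_mul (hS m) hε)).add (isBigO_one_mul (hQ m) hε2)
    -- The error splits into the old error times the new factor (`t1`), the old truncation times the
    -- new error (`t2`), and the terms of order ε³ and higher in the product of the truncations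
    -- (`t3`).
    have t1 := (ih.mul hfm).congr_right fun z => mul_one (ε z ^ 3)
    have t2 := (hA.mul (hf m)).congr_right fun z => one_mul (ε z ^ 3)
    have t3 := ((((isBigO_one_mul (hS m) (hk γ)).add
        (isBigO_one_mul (hQ m) (hc.add (hk (m : ℝ))))).add
        (isBigO_one_mul (isBigO_one_mul (hQ m) (hk γ)) hε)).mul (isBigO_refl (fun z => ε z ^ 3) l)).congr_right
        fun z => one_mul (ε z ^ 3)
    refine ((t1.add t2).add t3).congr_left fun z => ?_
    rw [Finset.prod_range_succ]
    push_cast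
    ring

theorem fluct_bound (η : ℝ) : |fluct η| ≤ 1 := by
  unfold fluct
  have h1 := Int.floor_le η
  have h2 := Int.lt_floor_add_one η
  exact abs_le.2 ⟨by linarith, by linarith⟩

/-- The two-term expansion of the shifted frequency. -/
theorem shifted_frequency_bound {n w z : ℝ} (hn : 0 ≤ n) (hw : 0 ≤ w) (hz : 1 ≤ z)
    (h : w * (w + n) = z) :
    |(w + n / 2) * (√z)⁻¹ - (1 + n ^ 2 / 8 * (√z)⁻¹ ^ 2)| ≤ n ^ 4 * (√z)⁻¹ ^ 3 := by
  set t := √z with ht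
  have ht1 : 1 ≤ t := Real.one_le_sqrt.2 hz
  have htz : t ^ 2 = z := Real.sq_sqrt (by linarith)
  set S := w + n / 2 with hS
  -- Centring at w + n/2 removes the linear term, so S and √z differ by O(z^{-1/2}).
  have hS2 : S ^ 2 = t ^ 2 + n ^ 2 / 4 := by rw [htz, ← h, hS]; ring
  have hSt : t ≤ S := by
    refine (sq_le_sq₀ (by linarith) (by positivity)).1 ?_
    rw [hS2]
    nlinarith [sq_nonneg n]
  have ht0 : 0 < t := by linarith
  have hSt0 : 0 < S + t := by linarith
  have e1 : S - t = n ^ 2 / 4 / (S + t) := by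
    rw [eq_div_iff hSt0.ne']
    nlinarith
  -- Substituting n² = 4(S-t)(S+t) gives the exact remainder -(S-t)²/(2t²), of order t⁻⁴; order t⁻³
  -- suffices.
  have e2 : S * t⁻¹ - (1 + n ^ 2 / 8 * t⁻¹ ^ 2) = -(n ^ 4 / (32 * t ^ 2 * (S + t) ^ 2)) := by
    have e3 : n ^ 2 = 4 * (S - t) * (S + t) := by nlinarith
    rw [show n ^ 4 = (n ^ 2) ^ 2 by ring, e3]
    field_simp
    ring
  rw [e2, abs_neg, abs_of_nonneg (by positivity), inv_pow, ← div_eq_mul_inv]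
  refine div_le_div_of_nonneg_left (by positivity) (by positivity) ?_
  have : t ^ 2 ≤ (S + t) ^ 2 := pow_le_pow_left₀ ht0.le (by linarith) 2
  have : t ^ 3 ≤ t ^ 2 * t ^ 2 := by nlinarith [pow_pos ht0 3]
  nlinarith [pow_pos ht0 2]

/-- The binomial times (n+1)! is a rising factorial in ⌊w⌋ = w - (1/2 + `fluct w`); n/2 is added and
subtracted to isolate the centred frequency w + n/2. -/
theorem toReal_eigenCount {n s : ℕ} (hs : s ≤ 1) {z w : ℝ} (hw : 0 ≤ w)
    (hz : w * (w + ((n + 1 : ℕ) : ℝ) - 1) = z) :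
    (eigenCount (formDomain (n + 1) s) z).toReal
      = ((n + 1).factorial : ℝ)⁻¹ * ∏ j ∈ Finset.range (n + 1),
        (w + n / 2 + (1 - s - (1 / 2 + fluct w) - n / 2 + j)) := by
  rw [eigenCount_eq_choose hs hw hz, ENNReal.toReal_natCast]
  have h1 := Nat.ascFactorial_eq_factorial_mul_choose' (⌊w⌋₊ + 1 - s) (n + 1)
  rw [Nat.ascFactorial_eq_prod_range, show ⌊w⌋₊ + 1 - s + (n + 1) - 1 = ⌊w⌋₊ + 1 - s + n by omega]
    at h1
  have h2 := congrArg (Nat.cast (R := ℝ)) h1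
  push_cast [Nat.cast_sub (show s ≤ ⌊w⌋₊ + 1 by omega)] at h2
  have hf : ((n + 1).factorial : ℝ) ≠ 0 := by exact_mod_cast (n + 1).factorial_ne_zero
  have h3 : ∏ j ∈ Finset.range (n + 1), (w + n / 2 + (1 - s - (1 / 2 + fluct w) - n / 2 + j))
      = ((n + 1).factorial : ℝ) * ((⌊w⌋₊ + 1 - s + n).choose (n + 1) : ℕ) := by
    rw [← h2]
    refine Finset.prod_congr rfl fun j _ => ?_
    rw [natCast_floor_eq_intCast_floor hw, fluct]
    ring
  rw [h3, inv_mul_cancel_left₀ hf]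

/-- The product expansion is applied with m = d = n+1, γ = n²/8 and c = a - n/2, where a = 1 - s -
(1/2 + ψ). The centring cancels the terms linear in a at order ε², which leaves d(d-1)/2 · (a² +
(d-2)/6). -/
theorem weyl_expansion {n s : ℕ} (hs : s ≤ 1) {w : ℝ → ℝ}
    (hw : ∀ z : ℝ, 0 ≤ z → 0 ≤ w z ∧ w z * (w z + ((n + 1 : ℕ) : ℝ) - 1) = z) :
    (fun z : ℝ => (eigenCount (formDomain (n + 1) s) z).toReal
        / (((n + 1).factorial : ℝ)⁻¹ * z ^ (((n + 1 : ℕ) : ℝ) / 2))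
      - (1 + ((n + 1 : ℕ) : ℝ) * (1 - s - (1 / 2 + fluct (w z))) * z ^ (-(1 / 2) : ℝ)
        + ((n + 1 : ℕ) : ℝ) * (((n + 1 : ℕ) : ℝ) - 1) / 2
          * ((1 - s - (1 / 2 + fluct (w z))) ^ 2 + (((n + 1 : ℕ) : ℝ) - 2) / 6) * z ^ (-1 : ℝ)))
      =O[atTop] fun z : ℝ => z ^ (-(3 / 2) : ℝ) := by
  set ε : ℝ → ℝ := fun z => (√z)⁻¹ with hεdef
  set c : ℝ → ℝ := fun z => 1 - s - (1 / 2 + fluct (w z)) - n / 2 with hcdef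
  have hε : ε =O[atTop] fun _ => (1 : ℝ) := by
    refine IsBigO.of_bound 1 ?_
    filter_upwards [eventually_ge_atTop 1] with z hz
    have : 1 ≤ √z := Real.one_le_sqrt.2 hz
    simpa [hεdef, abs_of_pos (lt_of_lt_of_le one_pos this)] using inv_le_one_of_one_le₀ this
  have hk : ∀ r : ℝ, (fun _ : ℝ => r) =O[atTop] fun _ => (1 : ℝ) :=
    fun r => isBigO_const_const r one_ne_zero _
  have hfl : (fun z => fluct (w z)) =O[atTop] fun _ => (1 : ℝ) :=
    IsBigO.of_bound 1 (Eventually.of_forall fun z => by simpa using fluct_bound (w z))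
  have hc : c =O[atTop] fun _ => (1 : ℝ) := ((hk _).sub ((hk _).add hfl)).sub (hk _)
  have hw' : ∀ z : ℝ, 0 ≤ z → w z * (w z + n) = z := fun z hz => by
    have := (hw z hz).2
    push_cast at this
    linarith
  have hf : ∀ j : ℕ, (fun z => (w z + n / 2 + (c z + j)) * ε z
      - (1 + (c z + j) * ε z + (n : ℝ) ^ 2 / 8 * ε z ^ 2)) =O[atTop] fun z => ε z ^ 3 := by
    intro j
    refine IsBigO.of_bound ((n : ℝ) ^ 4) ?_
    filter_upwards [eventually_ge_atTop 1] with z hz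
    have h1 := shifted_frequency_bound n.cast_nonneg (hw z (by linarith)).1 hz
      (hw' z (by linarith))
    rw [Real.norm_eq_abs, Real.norm_eq_abs, abs_of_nonneg (show 0 ≤ ε z ^ 3 by positivity)]
    refine le_of_eq_of_le ?_ h1
    congr 1
    ring
  have hexp := isBigO_prod_expansion hε hc hf (n + 1)
  have hpow : ∀ᶠ z : ℝ in atTop, z ^ (-(1 / 2) : ℝ) = ε z ∧ z ^ (-1 : ℝ) = ε z ^ 2 ∧
      z ^ (-(3 / 2) : ℝ) = ε z ^ 3 ∧ z ^ (((n + 1 : ℕ) : ℝ) / 2) = (ε z ^ (n + 1))⁻¹ := by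
    filter_upwards [eventually_gt_atTop 0] with z hz
    have e1 : z ^ (-(1 / 2) : ℝ) = ε z := by
      rw [Real.rpow_neg hz.le, ← Real.sqrt_eq_rpow]
    refine ⟨e1, ?_, ?_, ?_⟩
    · rw [← e1, ← Real.rpow_mul_natCast hz.le]
      norm_num
    · rw [← e1, ← Real.rpow_mul_natCast hz.le]
      norm_num
    · rw [← e1, ← Real.rpow_mul_natCast hz.le, ← Real.rpow_neg hz.le]
      congr 1
      ring
  refine hexp.congr' ?_ ?_
  · filter_upwards [hpow, eventually_ge_atTop 1] with z ⟨h1, h2, _, h4⟩ hz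
    rw [h1, h2, h4, toReal_eigenCount hs (hw z (by linarith)).1 (hw z (by linarith)).2,
      Finset.prod_mul_distrib, Finset.prod_const, Finset.card_range]
    have hεz : ε z ≠ 0 := by
      have : 0 < √z := Real.sqrt_pos.2 (by linarith)
      exact (inv_pos.2 this).ne'
    have hfac : ((n + 1).factorial : ℝ) ≠ 0 := by exact_mod_cast (n + 1).factorial_ne_zero
    rw [mul_div_mul_left _ _ (inv_ne_zero hfac), div_inv_eq_mul]
    simp only [hcdef]
    push_cast
    ring
  · filter_upwards [hpow] with z hz
    exact hz.2.2.1.symm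

end Expansion

end HemisphereWeyl
end

theorem mainTheorem4 (d : ℕ) (hd : 2 ≤ d) (w : ℝ → ℝ)
    (hw : ∀ z : ℝ, 0 ≤ z → 0 ≤ w z ∧ w z * (w z + (d : ℝ) - 1) = z) :
    -- the counting functions are finite
    (∀ z : ℝ, countDirichlet d z ≠ ⊤ ∧ countNeumann d z ≠ ⊤) ∧
    -- Dirichlet
    ((fun z : ℝ =>
        (countDirichlet d z).toReal / (semiclassicalConst 0 d * hemiArea d * z ^ ((d : ℝ) / 2))
        - (1 - 1 / 4 * (semiclassicalConst 0 ((d : ℝ) - 1) / semiclassicalConst 0 d)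
              * (equatorArea d / hemiArea d) * (1 + 2 * fluct (w z)) * z ^ (-(1 / 2) : ℝ)
            + (d : ℝ) * ((d : ℝ) - 1) / 2
              * ((1 / 2 + fluct (w z)) ^ 2 + ((d : ℝ) - 2) / 6) * z ^ (-1 : ℝ)))
      =O[Filter.atTop] fun z : ℝ => z ^ (-(3 / 2) : ℝ)) ∧
    ((fun z : ℝ =>
        (countDirichlet d z).toReal / (semiclassicalConst 0 d * hemiArea d * z ^ ((d : ℝ) / 2))
        - (1 - (d : ℝ) * (1 + 2 * fluct (w z)) / 2 * z ^ (-(1 / 2) : ℝ)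
            + (d : ℝ) * ((d : ℝ) - 1) / 2
              * ((1 / 2 + fluct (w z)) ^ 2 + ((d : ℝ) - 2) / 6) * z ^ (-1 : ℝ)))
      =O[Filter.atTop] fun z : ℝ => z ^ (-(3 / 2) : ℝ)) ∧
    -- Neumann
    ((fun z : ℝ =>
        (countNeumann d z).toReal / (semiclassicalConst 0 d * hemiArea d * z ^ ((d : ℝ) / 2))
        - (1 + 1 / 4 * (semiclassicalConst 0 ((d : ℝ) - 1) / semiclassicalConst 0 d)
              * (equatorArea d / hemiArea d) * (1 - 2 * fluct (w z)) * z ^ (-(1 / 2) : ℝ)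
            + (d : ℝ) * ((d : ℝ) - 1) / 2
              * ((1 / 2 - fluct (w z)) ^ 2 + ((d : ℝ) - 2) / 6) * z ^ (-1 : ℝ)))
      =O[Filter.atTop] fun z : ℝ => z ^ (-(3 / 2) : ℝ)) ∧
    ((fun z : ℝ =>
        (countNeumann d z).toReal / (semiclassicalConst 0 d * hemiArea d * z ^ ((d : ℝ) / 2))
        - (1 + (d : ℝ) * (1 - 2 * fluct (w z)) / 2 * z ^ (-(1 / 2) : ℝ)
            + (d : ℝ) * ((d : ℝ) - 1) / 2
              * ((1 / 2 - fluct (w z)) ^ 2 + ((d : ℝ) - 2) / 6) * z ^ (-1 : ℝ)))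
      =O[Filter.atTop] fun z : ℝ => z ^ (-(3 / 2) : ℝ)) := by
  obtain ⟨n, rfl⟩ : ∃ n, d = n + 1 := ⟨d - 1, by omega⟩
  have hq := HemisphereWeyl.quarter_ratio n
  -- Here a = 1/2 - ψ for s = 0 and a = -(1/2 + ψ) for s = 1, which accounts for the different signs
  -- in the two expansions.
  have hN := HemisphereWeyl.weyl_expansion (n := n) (s := 0) zero_le_one hw
  have hD := HemisphereWeyl.weyl_expansion (n := n) (s := 1) le_rfl hw
  rw [← HemisphereWeyl.semiclassicalConst_mul_hemiArea] at hN hD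
  refine ⟨fun z => ⟨HemisphereWeyl.eigenCount_ne_top (s := 1) le_rfl z,
    HemisphereWeyl.eigenCount_ne_top (s := 0) zero_le_one z⟩,
    hD.congr_left fun z => ?_, hD.congr_left fun z => ?_,
    hN.congr_left fun z => ?_, hN.congr_left fun z => ?_⟩
  · rw [hq]
    simp only [countDirichlet, HemisphereWeyl.formDomain]
    push_cast
    ring
  · simp only [countDirichlet, HemisphereWeyl.formDomain]
    push_cast
    ring
  · rw [hq]
    simp only [countNeumann, HemisphereWeyl.formDomain]
    push_cast
    ring
  · simp only [countNeumann, HemisphereWeyl.formDomain]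
    push_cast
    ring
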